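/- We work over $\mathbb{C}$. The Waring rank $r(F)$ of a form $F$ of degree $d$ is the least $r$ such that $F = c_1\ell_1^d + \dotsb + c_r\ell_r^d$ for some linear forms $\ell_i$ and scalars $c_i$; $r_{\max}(n,d)$ denotes the maximum Waring rank of forms of degree $d$ in $n$ variables. The apolar length of $F \in \mathbb{C}[x_1,\dotsc,x_m]$ is the dimension of the vector space $\{\Theta(\partial/\partial x_1,\dotsc,\partial/\partial x_m)F : \Theta \in \mathbb{C}[\alpha_1,\dotsc,\alpha_m]\}$ spanned by all partial derivatives of $F$ of all orders (including $F$ itself). A property holds for a general element of a finite-dimensional complex vector space if it holds on a nonempty Zariski-open subset. Let $\mathrm{al}_{\mathrm{gen}}(m,e)$ be the apolar length of a general form of degree $e$ in $m$ variables. **Theorem.** Let $n \ge 3$ and let $d = 2k+1 \ge 3$ be odd. A general form of degree $d-1$ in $n-1$ variables has apolar length $$\mathrm{al}_{\mathrm{gen}}(n-1,d-1) = \binom{n+k-2}{n-1} + \binom{n+k-1}{n-1},$$ and there is a form of degree $d$ in $n$ variables whose Waring rank is strictly greater than this number; that is, $$r_{\max}(n,d) > \mathrm{al}_{\mathrm{gen}}(n-1,d-1).$$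 Moreover, such a form can be found as follows. Let $s = \binom{n+k-2}{k} - 1$, let $\ell_1,\dotsc,\ell_s$ be general linear forms in $x_2,\dotsc,x_n$ (that is, $(\ell_1,\dotsc,\ell_s)$ is a general $s$-tuple), and let $G = \ell_1^{d-1} + \dotsb + \ell_s^{d-1}$. Then there is a form $K$ of degree $d$ in $x_2,\dotsc,x_n$ such that $F = x_1 G + K$ satisfies $r(F) > \mathrm{al}_{\mathrm{gen}}(n-1,d-1)$. If $n \ge 4$, then, for each such $G$, this inequality holds for a general form $K$ of degree $d$ in $x_2,\dotsc,x_n$. -/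

import Mathlib

noncomputable section

/-- The complex vector space of forms (homogeneous polynomials) of degree `e` in the `m` variables
`X 0, …, X (m - 1)`. The zero polynomial is included. -/
abbrev Form (m e : ℕ) : Type :=
  ↥(MvPolynomial.homogeneousSubmodule (Fin m) ℂ e)

/-- The Waring rank of a form `F` of degree `d`: the least `r` such that there are linear forms
`ℓ 0, …, ℓ (r - 1)` and scalars `c 0, …, c (r - 1)` with `F = ∑ i, c i * (ℓ i) ^ d`. -/
def waringRank {m : ℕ} (d : ℕ) (F : MvPolynomial (Fin m) ℂ) : ℕ :=
  sInf {r : ℕ | ∃ (ℓ : Fin r → MvPolynomial (Fin m) ℂ) (c : Fin r → ℂ),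
    (∀ i, (ℓ i).IsHomogeneous 1) ∧ F = ∑ i, c i • ℓ i ^ d}

/-- The maximum Waring rank of forms of degree `d` in `m` variables. -/
def maxWaringRank (m d : ℕ) : ℕ :=
  sSup {r : ℕ | ∃ F : Form m d, waringRank d (F : MvPolynomial (Fin m) ℂ) = r}

/-- The differential operator `∏ i, (∂ / ∂ x i) ^ (a i)` attached to an exponent vector `a`. -/
def monomialDerivative {m : ℕ} (a : Fin m →₀ ℕ) : Module.End ℂ (MvPolynomial (Fin m) ℂ) :=
  (List.ofFn fun i : Fin m =>
    (MvPolynomial.pderiv (R := ℂ) i).toLinearMap ^ a i).prod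

/-- The apolarity action: a polynomial `Θ` in the dual variables acts on polynomials as the
differential operator obtained by substituting `∂ / ∂ x i` for the `i`-th dual variable. -/
def apolarAction (m : ℕ) :
    MvPolynomial (Fin m) ℂ →ₗ[ℂ] Module.End ℂ (MvPolynomial (Fin m) ℂ) :=
  (MvPolynomial.basisMonomials (Fin m) ℂ).constr ℂ monomialDerivative

/-- `Diff F`: the space of all derivatives `Θ ⌟ F` of `F`, for `Θ` in the dual polynomial ring. -/
def derivativeSpace {m : ℕ} (F : MvPolynomial (Fin m) ℂ) :
    Submodule ℂ (MvPolynomial (Fin m) ℂ) :=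
  LinearMap.range ((apolarAction m).flip F)

/-- The apolar length of `F`: the dimension of the space of all derivatives of `F`. -/
def apolarLength {m : ℕ} (F : MvPolynomial (Fin m) ℂ) : ℕ :=
  Module.finrank ℂ (derivativeSpace F)

/-- The algebra of polynomial functions on a complex vector space. -/
def polynomialFunctionAlgebra (V : Type*) [AddCommGroup V] [Module ℂ V] : Subalgebra ℂ (V → ℂ) :=
  Algebra.adjoin ℂ {f : V → ℂ | ∃ φ : Module.Dual ℂ V, f = fun v => φ v}

/-- `P v` holds for a general `v` in `V`: there is a nonempty Zariski-open subset of `V` all of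
whose points satisfy `P`. Since the principal open sets `{v | f v ≠ 0}`, for `f` a polynomial
function, are a basis of the Zariski topology, it is enough to allow these. -/
def HoldsForGeneral (V : Type*) [AddCommGroup V] [Module ℂ V] (P : V → Prop) : Prop :=
  ∃ f ∈ polynomialFunctionAlgebra V, (∃ v, f v ≠ 0) ∧ ∀ v, f v ≠ 0 → P v

/-- The apolar length of a general form of degree `e` in `m` variables: the number `a` such that a
general form has apolar length `a`. (Two nonempty Zariski-open sets of forms meet, so there is at
most one such `a`.) -/
def generalApolarLength (m e : ℕ) : ℕ :=
  sInf {a : ℕ | HoldsForGeneral (Form m e)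
    fun H => apolarLength (H : MvPolynomial (Fin m) ℂ) = a}

/-- Regard a polynomial in `n - 1` variables as a polynomial in the last `n - 1` of `n` variables,
that is, one that does not involve the first variable. -/
def inLastVariables (n : ℕ) (p : MvPolynomial (Fin (n - 1)) ℂ) : MvPolynomial (Fin n) ℂ :=
  MvPolynomial.rename (fun i : Fin (n - 1) => (⟨i + 1, by omega⟩ : Fin n)) p

end

section

open MvPolynomial Finset

/-! Put m = n - 1, let S_j be the forms of degree j in the last m variables, and let g and K denote
pairing with G and with K. In a decomposition of F = x₁G + K, the linear forms involving x₁
normalise to points x_i of affine m-space; the others give points y_j at infinity. As F is linear in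
x₁, a weighted sum φ of evaluations at the x_i vanishes in degrees below 2k, equals g in degree 2k,
and in degree 2k + 1 equals K up to evaluations at the y_j (`exists_points_of_coneForm_eq`). Hence a
polynomial of degree at most 2k vanishing at all x_i has its leading form in the annihilator of g
(`RepresentsAtPoints.leading_mem_perp`), and there are at least as many x_i as the apolar length of
G.

G is a sum of one power fewer than dim S_k, so its middle catalecticant has a one-dimensional
kernel, spanned by a form q through the points dual to the ℓ_i; the apolar length of G is one below
the general value A. Suppose the decomposition has at most A terms. Either some polynomial with
leading form q vanishes at the x_i, and there is at most one y_j; or the x_i already number A, there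
is no y_j, and polynomials with components in complements of the annihilators (all of S_k in degree
k) interpolate uniquely at the x_i. Both cases force K(hq) = t h(p) q(p), with one point p and
scalar t, for all h of degree k + 1 annihilating g (`exists_eq_eval_of_card_le`).

It remains to choose K violating this. Taking h = q X_i shows that the vector P = (K(q² X_i))_i
equals t q(p)² p. If P is prescribed to be a nonzero zero of q, this is absurd
(`exists_expectedLength_lt_waringRank`). For m ≥ 3 some h is not a multiple of q, and the identity
K(hq) q(P) = h(P) fails for general K (`holdsForGeneral_expectedLength_lt_waringRank`).

The value of A comes from the Hilbert function of a form with nondegenerate middle catalecticant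
(`finrank_range_mulForm`), a condition satisfied by general forms. -/

/-- The factorial `a! = ∏ i, (a i)!` of an exponent vector, as a complex number. -/
def exponentFactorial {m : ℕ} (a : Fin m →₀ ℕ) : ℂ := ∏ i, ((a i).factorial : ℂ)

lemma exponentFactorial_ne_zero {m : ℕ} (a : Fin m →₀ ℕ) : exponentFactorial a ≠ 0 :=
  Finset.prod_ne_zero_iff.2 fun _ _ => Nat.cast_ne_zero.2 (Nat.factorial_ne_zero _)

lemma exponentFactorial_add_single {m : ℕ} (a : Fin m →₀ ℕ) (i : Fin m) :
    exponentFactorial (a + Finsupp.single i 1) = exponentFactorial a * (a i + 1) := by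
  unfold exponentFactorial
  rw [← Finset.mul_prod_erase _ _ (Finset.mem_univ i),
    ← Finset.mul_prod_erase (s := Finset.univ) (fun j => ((a j).factorial : ℂ)) (Finset.mem_univ i)]
  have h : ∀ j ∈ Finset.univ.erase i, (((a + Finsupp.single i 1 : Fin m →₀ ℕ) j).factorial : ℂ) =
      ((a j).factorial : ℂ) := by
    intro j hj
    rw [Finsupp.add_apply, Finsupp.single_eq_of_ne (Finset.ne_of_mem_erase hj), add_zero]
  rw [Finset.prod_congr rfl h]
  simp [Nat.factorial_succ]
  ring

/-! ### The apolar pairing and its relation to derivatives -/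

/-- The apolar pairing `⟨Θ, F⟩ = ∑ a, a! * Θ_a * F_a`. -/
noncomputable def apolarPairing (m : ℕ) :
    MvPolynomial (Fin m) ℂ →ₗ[ℂ] MvPolynomial (Fin m) ℂ →ₗ[ℂ] ℂ :=
  (MvPolynomial.basisMonomials (Fin m) ℂ).constr ℂ
    fun a => exponentFactorial a • MvPolynomial.lcoeff ℂ a

lemma apolarPairing_monomial {m : ℕ} (a : Fin m →₀ ℕ) (F : MvPolynomial (Fin m) ℂ) :
    apolarPairing m (monomial a 1) F = exponentFactorial a * coeff a F := by
  have h := (MvPolynomial.basisMonomials (Fin m) ℂ).constr_basis ℂ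
    (fun a => exponentFactorial a • MvPolynomial.lcoeff ℂ a) a
  rw [MvPolynomial.coe_basisMonomials] at h
  unfold apolarPairing
  rw [h]
  simp [MvPolynomial.lcoeff]

lemma apolarAction_monomial {m : ℕ} (a : Fin m →₀ ℕ) :
    apolarAction m (monomial a 1) = monomialDerivative a := by
  have h := (MvPolynomial.basisMonomials (Fin m) ℂ).constr_basis ℂ monomialDerivative a
  rwa [MvPolynomial.coe_basisMonomials] at h

/-- Linear maps out of the polynomial ring agree if they agree on monomials. -/
lemma linearMap_ext_monomial {m : ℕ} {M : Type*} [AddCommMonoid M] [Module ℂ M]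
    {f g : MvPolynomial (Fin m) ℂ →ₗ[ℂ] M} (h : ∀ a, f (monomial a 1) = g (monomial a 1)) :
    f = g :=
  (MvPolynomial.basisMonomials (Fin m) ℂ).ext fun a => by
    simpa [MvPolynomial.coe_basisMonomials] using h a

lemma apolarPairing_mul_X {m : ℕ} (i : Fin m) (Θ F : MvPolynomial (Fin m) ℂ) :
    apolarPairing m (Θ * X i) F = apolarPairing m Θ (pderiv i F) := by
  suffices h : (apolarPairing m).flip F ∘ₗ LinearMap.mulRight ℂ (X i) =
      (apolarPairing m).flip (pderiv i F) from LinearMap.congr_fun h Θ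
  refine linearMap_ext_monomial fun a => ?_
  have h1 : (monomial a (1 : ℂ)) * X i = monomial (a + Finsupp.single i 1) 1 := by
    rw [monomial_add_single, pow_one]
  simp only [LinearMap.comp_apply, LinearMap.mulRight_apply, LinearMap.flip_apply, h1,
    apolarPairing_monomial, exponentFactorial_add_single, coeff_pderiv]
  ring

/-- `T` lowers exponents by `b` with the coefficients of the iterated derivative. -/
def ActsAsDerivative {m : ℕ} (T : Module.End ℂ (MvPolynomial (Fin m) ℂ)) (b : Fin m →₀ ℕ) : Prop :=
  ∀ F c, exponentFactorial c * coeff c (T F) = exponentFactorial (b + c) * coeff (b + c) F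

lemma ActsAsDerivative.one {m : ℕ} :
    ActsAsDerivative (1 : Module.End ℂ (MvPolynomial (Fin m) ℂ)) 0 := by
  intro F c; simp

lemma ActsAsDerivative.mul {m : ℕ} {S T : Module.End ℂ (MvPolynomial (Fin m) ℂ)}
    {a b : Fin m →₀ ℕ} (hS : ActsAsDerivative S a) (hT : ActsAsDerivative T b) :
    ActsAsDerivative (S * T) (a + b) := by
  intro F c
  rw [Module.End.mul_apply, hS, hT, ← add_assoc, add_comm b a]

lemma ActsAsDerivative.pderiv {m : ℕ} (i : Fin m) :
    ActsAsDerivative (MvPolynomial.pderiv (R := ℂ) i).toLinearMap (Finsupp.single i 1) := by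
  intro F c
  rw [add_comm (Finsupp.single i 1), exponentFactorial_add_single]
  simp only [Derivation.coeFn_coe, coeff_pderiv]
  ring

lemma ActsAsDerivative.pow {m : ℕ} {T : Module.End ℂ (MvPolynomial (Fin m) ℂ)}
    {b : Fin m →₀ ℕ} (hT : ActsAsDerivative T b) (e : ℕ) : ActsAsDerivative (T ^ e) (e • b) := by
  induction e with
  | zero => simpa using ActsAsDerivative.one
  | succ e ih => rw [pow_succ, succ_nsmul]; exact ih.mul hT

lemma ActsAsDerivative.prod_ofFn {m : ℕ} : ∀ {r : ℕ}
    {T : Fin r → Module.End ℂ (MvPolynomial (Fin m) ℂ)} {b : Fin r → Fin m →₀ ℕ},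
    (∀ i, ActsAsDerivative (T i) (b i)) → ActsAsDerivative (List.ofFn T).prod (∑ i, b i)
  | 0, _, _, _ => by simpa using ActsAsDerivative.one
  | r + 1, T, b, h => by
    rw [List.ofFn_succ, List.prod_cons, Fin.sum_univ_succ]
    exact (h 0).mul (ActsAsDerivative.prod_ofFn fun i => h i.succ)

lemma actsAsDerivative_monomialDerivative {m : ℕ} (a : Fin m →₀ ℕ) :
    ActsAsDerivative (monomialDerivative a) a := by
  have h := ActsAsDerivative.prod_ofFn
    (fun i : Fin m => (ActsAsDerivative.pderiv i).pow (a i))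
  have h2 : ∑ i, a i • Finsupp.single i 1 = a := by
    conv_rhs => rw [← Finsupp.univ_sum_single a]
    simp
  rwa [h2] at h

/-- Multiplication is adjoint to differentiation, and pairing with a monomial reads off a
coefficient. Questions about derivatives thus become questions about the bilinear form `mulForm`. -/
lemma exponentFactorial_mul_coeff_apolarAction {m : ℕ} (Θ F : MvPolynomial (Fin m) ℂ)
    (c : Fin m →₀ ℕ) :
    exponentFactorial c * coeff c (apolarAction m Θ F) =
      apolarPairing m (Θ * monomial c 1) F := by
  suffices h : exponentFactorial c • (MvPolynomial.lcoeff ℂ c) ∘ₗ (apolarAction m).flip F =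
      (apolarPairing m).flip F ∘ₗ LinearMap.mulRight ℂ (monomial c 1) by
    simpa [MvPolynomial.lcoeff] using LinearMap.congr_fun h Θ
  refine linearMap_ext_monomial fun a => ?_
  simp only [LinearMap.comp_apply, LinearMap.smul_apply, LinearMap.flip_apply,
    LinearMap.mulRight_apply, monomial_mul, one_mul, apolarPairing_monomial,
    apolarAction_monomial, smul_eq_mul]
  exact actsAsDerivative_monomialDerivative a F c

/-- The bilinear form `(Θ, Ψ) ↦ g (Θ * Ψ)` attached to a functional `g`. -/
noncomputable def mulForm {m : ℕ} (g : Module.Dual ℂ (MvPolynomial (Fin m) ℂ)) :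
    MvPolynomial (Fin m) ℂ →ₗ[ℂ] Module.Dual ℂ (MvPolynomial (Fin m) ℂ) :=
  (LinearMap.mul ℂ (MvPolynomial (Fin m) ℂ)).compr₂ g

@[simp] lemma mulForm_apply {m : ℕ} (g : Module.Dual ℂ (MvPolynomial (Fin m) ℂ))
    (f h : MvPolynomial (Fin m) ℂ) : mulForm g f h = g (f * h) := rfl

/-- Both maps have the same kernel: Θ kills F exactly when Θ times every monomial pairs to zero with
F. -/
lemma apolarLength_eq_finrank_range {m : ℕ} (F : MvPolynomial (Fin m) ℂ) :
    apolarLength F = Module.finrank ℂ (LinearMap.range (mulForm ((apolarPairing m).flip F))) := by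
  have hker : LinearMap.ker ((apolarAction m).flip F) =
      LinearMap.ker (mulForm ((apolarPairing m).flip F)) := by
    ext Θ
    rw [LinearMap.mem_ker, LinearMap.mem_ker]
    constructor
    · intro h
      refine linearMap_ext_monomial fun c => ?_
      rw [mulForm_apply, LinearMap.flip_apply, ← exponentFactorial_mul_coeff_apolarAction]
      rw [LinearMap.flip_apply] at h
      simp [h]
    · intro h
      ext c
      have h1 := exponentFactorial_mul_coeff_apolarAction Θ F c
      have h2 := LinearMap.congr_fun h (monomial c 1)
      rw [mulForm_apply, LinearMap.flip_apply] at h2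
      rw [h2, LinearMap.zero_apply] at h1
      simpa using (mul_eq_zero.1 h1).resolve_left (exponentFactorial_ne_zero c)
  unfold apolarLength derivativeSpace
  exact ((LinearMap.quotKerEquivRange _).symm.trans
    ((Submodule.quotEquivOfEq _ _ hker).trans (LinearMap.quotKerEquivRange _))).finrank_eq

/-! ### Powers of linear forms -/

/-- The point dual to a linear form: its vector of coefficients. -/
noncomputable def linearFormPoint {m : ℕ} (ℓ : MvPolynomial (Fin m) ℂ) : Fin m → ℂ :=
  fun i => coeff (Finsupp.single i 1) ℓ

/-- The linear form with the given coefficients. -/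
noncomputable def pointLinearForm {m : ℕ} (p : Fin m → ℂ) : MvPolynomial (Fin m) ℂ := ∑ i, C (p i) * X i

lemma isHomogeneous_pointLinearForm {m : ℕ} (p : Fin m → ℂ) :
    (pointLinearForm p).IsHomogeneous 1 :=
  IsHomogeneous.sum _ _ _ fun _ _ => isHomogeneous_C_mul_X _ _

@[simp] lemma linearFormPoint_pointLinearForm {m : ℕ} (p : Fin m → ℂ) :
    linearFormPoint (pointLinearForm p) = p := by
  classical
  ext i
  simp [linearFormPoint, pointLinearForm, coeff_sum, coeff_C_mul, coeff_X, Finsupp.single_left_inj]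

lemma pderiv_linearForm {m : ℕ} {ℓ : MvPolynomial (Fin m) ℂ} (hℓ : ℓ.IsHomogeneous 1)
    (i : Fin m) : pderiv i ℓ = C (linearFormPoint ℓ i) := by
  classical
  ext c
  rw [coeff_pderiv, coeff_C]
  split_ifs with h
  · subst h; simp [linearFormPoint]
  · rw [hℓ.coeff_eq_zero, zero_mul]
    intro h2
    apply h
    have h3 : c.degree = 0 := by simpa [map_add] using h2
    exact ((Finsupp.degree_eq_zero_iff c).1 h3).symm

/-- Each derivative of a power of ℓ lowers the exponent and brings out a coordinate of its point.
This is the bridge from Waring decompositions to point evaluations. -/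
lemma apolarPairing_linearForm_pow {m : ℕ} {ℓ : MvPolynomial (Fin m) ℂ} (hℓ : ℓ.IsHomogeneous 1)
    {e : ℕ} {Θ : MvPolynomial (Fin m) ℂ} (hΘ : Θ.IsHomogeneous e) :
    apolarPairing m Θ (ℓ ^ e) = (e.factorial : ℂ) * eval (linearFormPoint ℓ) Θ := by
  have key : ∀ (e : ℕ) (a : Fin m →₀ ℕ), a.degree = e →
      apolarPairing m (monomial a 1) (ℓ ^ e) =
        (e.factorial : ℂ) * eval (linearFormPoint ℓ) (monomial a 1) := by
    intro e
    induction e with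
    | zero =>
      intro a ha
      obtain rfl := (Finsupp.degree_eq_zero_iff a).1 ha
      rw [apolarPairing_monomial]
      simp [exponentFactorial]
    | succ e ih =>
      intro a ha
      obtain ⟨i, hi⟩ : ∃ i, a i ≠ 0 := by
        by_contra! h
        have : a = 0 := Finsupp.ext h
        simp [this] at ha
      obtain ⟨b, rfl⟩ : ∃ b, a = b + Finsupp.single i 1 :=
        ⟨a - Finsupp.single i 1, (tsub_add_cancel_of_le
          (Finsupp.single_le_iff.2 (Nat.one_le_iff_ne_zero.2 hi))).symm⟩
      have hb : b.degree = e := by simpa [map_add] using ha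
      rw [monomial_add_single, pow_one, apolarPairing_mul_X, pderiv_pow, pderiv_linearForm hℓ]
      have h1 : ((e + 1 : ℕ) : MvPolynomial (Fin m) ℂ) * ℓ ^ (e + 1 - 1) *
          C (linearFormPoint ℓ i) = ((e + 1 : ℂ) * linearFormPoint ℓ i) • ℓ ^ e := by
        rw [smul_eq_C_mul, Nat.add_sub_cancel, C_mul]
        push_cast
        simp
        ring
      rw [h1, map_smul, ih b hb, map_mul, eval_X, Nat.factorial_succ, smul_eq_mul]
      push_cast
      ring
  rw [Θ.as_sum]
  simp only [map_sum, LinearMap.sum_apply, Finset.mul_sum]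
  refine Finset.sum_congr rfl fun a ha => ?_
  have h1 : monomial a (coeff a Θ) = coeff a Θ • monomial a 1 := by
    rw [smul_monomial, smul_eq_mul, mul_one]
  have hdeg : a.degree = e := by
    by_contra h
    exact (mem_support_iff.1 ha) (hΘ.coeff_eq_zero h)
  rw [h1, map_smul, LinearMap.smul_apply, key e a hdeg, smul_eq_C_mul, map_mul, eval_C,
    smul_eq_mul]
  ring

lemma apolarPairing_eq_zero_of_degree_ne {m i j : ℕ} {Θ F : MvPolynomial (Fin m) ℂ}
    (hΘ : Θ.IsHomogeneous i) (hF : F.IsHomogeneous j) (h : i ≠ j) : apolarPairing m Θ F = 0 := by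
  rw [Θ.as_sum]
  simp only [map_sum, LinearMap.sum_apply]
  refine Finset.sum_eq_zero fun a ha => ?_
  have h1 : monomial a (coeff a Θ) = coeff a Θ • monomial a 1 := by
    rw [smul_monomial, smul_eq_mul, mul_one]
  have hdeg : a.degree = i := by
    by_contra h
    exact (mem_support_iff.1 ha) (hΘ.coeff_eq_zero h)
  rw [h1, map_smul, LinearMap.smul_apply, apolarPairing_monomial,
    hF.coeff_eq_zero (by omega)]
  simp

lemma eval_smul_of_isHomogeneous {m j : ℕ} {f : MvPolynomial (Fin m) ℂ} (hf : f.IsHomogeneous j)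
    (t : ℂ) (p : Fin m → ℂ) : eval (t • p) f = t ^ j * eval p f := by
  rw [f.as_sum]
  simp only [map_sum, Finset.mul_sum]
  refine Finset.sum_congr rfl fun a ha => ?_
  have hdeg : a.degree = j := by
    by_contra h
    exact (mem_support_iff.1 ha) (hf.coeff_eq_zero h)
  rw [eval_monomial, eval_monomial, Finsupp.prod_fintype _ _ (by simp),
    Finsupp.prod_fintype _ _ (by simp)]
  simp only [Pi.smul_apply, smul_eq_mul, mul_pow, Finset.prod_mul_distrib, Finset.prod_pow_eq_pow_sum]
  rw [← hdeg, Finsupp.degree_eq_sum]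
  ring

/-! ### Dimensions of spaces of forms -/

instance finiteDimensional_form (m j : ℕ) : FiniteDimensional ℂ (Form m j) :=
  Module.Finite.iff_fg.2 (homogeneousSubmodule_fg (σ := Fin m) (R := ℂ) j)

lemma finrank_form (m j : ℕ) : Module.finrank ℂ (Form m j) = m.multichoose j := by
  classical
  let s : Finset (Fin m →₀ ℕ) := Finset.univ.finsuppAntidiag j
  have hs : ∀ a : Fin m →₀ ℕ, a ∈ s ↔ a.degree = j := fun a => by
    simp [s, Finset.mem_finsuppAntidiag, Finsupp.degree_eq_sum]
  have hspan : homogeneousSubmodule (Fin m) ℂ j =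
      Submodule.span ℂ (Set.range fun a : s => (monomial (a : Fin m →₀ ℕ) (1 : ℂ))) := by
    apply le_antisymm
    · intro f hf
      rw [f.as_sum]
      refine Submodule.sum_mem _ fun a ha => ?_
      have h1 : monomial a (coeff a f) = coeff a f • monomial a 1 := by
        rw [smul_monomial, smul_eq_mul, mul_one]
      have hdeg : a.degree = j := by
        by_contra h
        exact (mem_support_iff.1 ha) (IsHomogeneous.coeff_eq_zero hf h)
      rw [h1]
      exact Submodule.smul_mem _ _ (Submodule.subset_span ⟨⟨a, (hs a).2 hdeg⟩, rfl⟩)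
    · rw [Submodule.span_le]
      rintro _ ⟨a, rfl⟩
      exact isHomogeneous_monomial _ ((hs a).1 a.2)
  have hli : LinearIndependent ℂ fun a : s => (monomial (a : Fin m →₀ ℕ) (1 : ℂ)) := by
    have h := (MvPolynomial.basisMonomials (Fin m) ℂ).linearIndependent.comp
      (fun a : s => (a : Fin m →₀ ℕ)) Subtype.val_injective
    rw [MvPolynomial.coe_basisMonomials] at h
    exact h
  have h1 : Module.finrank ℂ (Form m j) = Module.finrank ℂ (Submodule.span ℂ
      (Set.range fun a : s => (monomial (a : Fin m →₀ ℕ) (1 : ℂ)))) := by rw [← hspan]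
  rw [h1, finrank_span_eq_card hli, Fintype.card_coe,
    Finset.card_finsuppAntidiag_nat_eq_multichoose]
  simp

/-! ### Polynomial functions -/

section PolynomialFunctions

variable {V : Type*} [AddCommGroup V] [Module ℂ V]

lemma dual_mem_polynomialFunctionAlgebra (φ : Module.Dual ℂ V) :
    (fun v => φ v) ∈ polynomialFunctionAlgebra V :=
  Algebra.subset_adjoin ⟨φ, rfl⟩

lemma eval_mem_polynomialFunctionAlgebra {m : ℕ} {φ : V → Fin m → ℂ}
    (hφ : ∀ i, (fun v => φ v i) ∈ polynomialFunctionAlgebra V) (f : MvPolynomial (Fin m) ℂ) :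
    (fun v => eval (φ v) f) ∈ polynomialFunctionAlgebra V := by
  induction f using MvPolynomial.induction_on with
  | C a => simp only [eval_C]; exact (polynomialFunctionAlgebra V).algebraMap_mem a
  | add p q hp hq => simp only [map_add]; exact (polynomialFunctionAlgebra V).add_mem hp hq
  | mul_X p i hp => simp only [map_mul, eval_X]; exact (polynomialFunctionAlgebra V).mul_mem hp (hφ i)

lemma det_mem_polynomialFunctionAlgebra {ι : Type*} [Fintype ι] [DecidableEq ι]
    {M : V → Matrix ι ι ℂ} (hM : ∀ i j, (fun v => M v i j) ∈ polynomialFunctionAlgebra V) :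
    (fun v => (M v).det) ∈ polynomialFunctionAlgebra V := by
  have h : (fun v => (M v).det) =
      ∑ σ : Equiv.Perm ι, ((Equiv.Perm.sign σ : ℤ) • ∏ i, fun v => M v (σ i) i) := by
    ext v
    simp [Matrix.det_apply', Finset.sum_apply, Finset.prod_apply]
  rw [h]
  exact Subalgebra.sum_mem _ fun σ _ => Subalgebra.zsmul_mem _
    (Subalgebra.prod_mem _ fun i _ => hM _ _) _

lemma exists_polynomial_line {f : V → ℂ} (hf : f ∈ polynomialFunctionAlgebra V) (v w : V) :
    ∃ p : Polynomial ℂ, ∀ t : ℂ, p.eval t = f (v + t • w) := by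
  induction hf using Algebra.adjoin_induction with
  | mem f hf =>
    obtain ⟨φ, rfl⟩ := hf
    exact ⟨Polynomial.C (φ v) + Polynomial.X * Polynomial.C (φ w), fun t => by simp; ring⟩
  | algebraMap r => exact ⟨Polynomial.C r, fun t => by simp⟩
  | add f g _ _ hf hg =>
    obtain ⟨p, hp⟩ := hf
    obtain ⟨q, hq⟩ := hg
    exact ⟨p + q, fun t => by simp [hp, hq]⟩
  | mul f g _ _ hf hg =>
    obtain ⟨p, hp⟩ := hf
    obtain ⟨q, hq⟩ := hg
    exact ⟨p * q, fun t => by simp [hp, hq]⟩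

/-- Two properties of a general element hold simultaneously somewhere. -/
lemma HoldsForGeneral.exists_and {P Q : V → Prop} (hP : HoldsForGeneral V P)
    (hQ : HoldsForGeneral V Q) : ∃ v, P v ∧ Q v := by
  obtain ⟨f, hf, ⟨v, hv⟩, hfP⟩ := hP
  obtain ⟨g, hg, ⟨w, hw⟩, hgQ⟩ := hQ
  -- On the line joining v and w, both functions become nonzero polynomials in one variable, so
  -- their product is not identically zero.
  obtain ⟨p, hp⟩ := exists_polynomial_line hf v (w - v)
  obtain ⟨q, hq⟩ := exists_polynomial_line hg v (w - v)
  have hp0 : p ≠ 0 := by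
    rintro rfl
    exact hv (by simpa using (hp 0).symm)
  have hq0 : q ≠ 0 := by
    rintro rfl
    exact hw (by simpa using (hq 1).symm)
  obtain ⟨t, ht⟩ : ∃ t, (p * q).eval t ≠ 0 := by
    by_contra! h
    exact mul_ne_zero hp0 hq0 (Polynomial.funext fun t => by simpa using h t)
  rw [Polynomial.eval_mul] at ht
  refine ⟨_, hfP (v + t • (w - v)) ?_, hgQ _ ?_⟩
  · rw [← hp]; exact left_ne_zero_of_mul ht
  · rw [← hq]; exact right_ne_zero_of_mul ht

end PolynomialFunctions

/-! ### Evaluation at general points -/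

/-- If a family of functionals separates the points of `V`, then `s ≤ dim V` of them can be chosen
to be linearly independent. -/
lemma exists_surjective_pi_of_separating {V P : Type*} [AddCommGroup V] [Module ℂ V]
    [FiniteDimensional ℂ V] (φ : P → Module.Dual ℂ V) (hφ : ∀ v, (∀ p, φ p v = 0) → v = 0) :
    ∀ s : ℕ, s ≤ Module.finrank ℂ V →
      ∃ p : Fin s → P, Function.Surjective (LinearMap.pi fun i => φ (p i))
  | 0, _ => ⟨Fin.elim0, fun w => ⟨0, Subsingleton.elim _ _⟩⟩
  | s + 1, hs => by
    obtain ⟨p, hp⟩ := exists_surjective_pi_of_separating φ hφ s (by omega)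
    -- Fewer functionals than the dimension have a common zero v ≠ 0. A functional not vanishing at
    -- v is the next one, and v serves to correct its value without disturbing the others.
    obtain ⟨v, hv, hv0⟩ : ∃ v ∈ LinearMap.ker (LinearMap.pi fun i => φ (p i)), v ≠ 0 := by
      refine Submodule.exists_mem_ne_zero_of_ne_bot fun h => ?_
      have h1 := LinearMap.finrank_range_add_finrank_ker (LinearMap.pi fun i => φ (p i))
      rw [h, finrank_bot, LinearMap.range_eq_top.2 hp, finrank_top, Module.finrank_fin_fun] at h1
      omega
    obtain ⟨x, hx⟩ : ∃ x, φ x v ≠ 0 := by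
      by_contra! h
      exact hv0 (hφ v h)
    refine ⟨Fin.cons x p, fun w => ?_⟩
    obtain ⟨u, hu⟩ := hp (fun i => w i.succ)
    refine ⟨u + ((w 0 - φ x u) / φ x v) • v, ?_⟩
    ext i
    refine Fin.cases ?_ (fun i => ?_) i
    · simp [hx]
    · have h1 := congrFun hu i
      have h2 := congrFun (LinearMap.mem_ker.1 hv) i
      simp only [LinearMap.pi_apply, Pi.zero_apply] at h1 h2
      simp [h1, h2]

/-- Evaluation of forms of degree `e` at finitely many points. -/
noncomputable def formEval {m : ℕ} (e : ℕ) {ι : Type*} (p : ι → Fin m → ℂ) :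
    Form m e →ₗ[ℂ] ι → ℂ :=
  LinearMap.pi fun i => (MvPolynomial.aeval (p i)).toLinearMap ∘ₗ Submodule.subtype _

@[simp] lemma formEval_apply {m e : ℕ} {ι : Type*} (p : ι → Fin m → ℂ) (f : Form m e) (i : ι) :
    formEval e p f i = eval (p i) (f : MvPolynomial (Fin m) ℂ) := by
  simp [formEval, MvPolynomial.aeval_eq_eval]

lemma exists_formEval_surjective {m e s : ℕ} (hs : s ≤ m.multichoose e) :
    ∃ p : Fin s → Fin m → ℂ, Function.Surjective (formEval e p) := by
  rw [← finrank_form] at hs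
  refine exists_surjective_pi_of_separating
    (fun p : Fin m → ℂ => (MvPolynomial.aeval p).toLinearMap ∘ₗ Submodule.subtype _) ?_ s hs
  intro v hv
  ext1
  refine MvPolynomial.funext fun p => ?_
  simpa [MvPolynomial.aeval_eq_eval] using hv p

/-- Some powers of linear forms are a basis of the space of forms. -/
lemma exists_form_eq_sum_smul_pow (m e : ℕ) :
    ∃ p : Fin (m.multichoose e) → Fin m → ℂ, ∀ F : Form m e, ∃ b : Fin (m.multichoose e) → ℂ,
      (F : MvPolynomial (Fin m) ℂ) = ∑ i, b i • pointLinearForm (p i) ^ e := by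
  obtain ⟨p, hp⟩ := exists_formEval_surjective (m := m) (e := e) le_rfl
  refine ⟨p, ?_⟩
  let v : Fin (m.multichoose e) → Form m e := fun i => ⟨pointLinearForm (p i) ^ e, by
    simpa using (isHomogeneous_pointLinearForm (p i)).pow e⟩
  have hv : LinearIndependent ℂ v := by
    rw [Fintype.linearIndependent_iff]
    intro b hb i
    -- A form equal to 1 at the i-th point and 0 at the others isolates the coefficient `b i`.
    obtain ⟨f, hf⟩ := hp (Pi.single i 1)
    have h1 : apolarPairing m f (∑ i, b i • pointLinearForm (p i) ^ e) = 0 := by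
      have h2 := congrArg (Submodule.subtype _) hb
      simp only [map_sum, map_smul, map_zero] at h2
      simp only [v, Submodule.subtype_apply] at h2
      rw [h2, map_zero]
    have h3 : ∀ j, apolarPairing m f (pointLinearForm (p j) ^ e) =
        (e.factorial : ℂ) * (Pi.single i 1 : _ → ℂ) j := fun j => by
      rw [apolarPairing_linearForm_pow (isHomogeneous_pointLinearForm _) f.2,
        linearFormPoint_pointLinearForm, ← formEval_apply, hf]
    simp only [map_sum, map_smul, h3, smul_eq_mul, Pi.single_apply, mul_ite, mul_one, mul_zero,
      Finset.sum_ite_eq', Finset.mem_univ, if_true, mul_eq_zero] at h1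
    exact h1.resolve_right (Nat.cast_ne_zero.2 (Nat.factorial_ne_zero _))
  have hspan := hv.span_eq_top_of_card_eq_finrank' (by rw [finrank_form, Fintype.card_fin])
  intro F
  obtain ⟨b, hb⟩ := (Submodule.mem_span_range_iff_exists_fun ℂ).1 (hspan ▸ Submodule.mem_top : F ∈ _)
  refine ⟨b, ?_⟩
  rw [← hb]
  simp [v]

/-- Every functional on forms of degree `e` is the apolar pairing with a form. -/
lemma exists_form_apolarPairing {m e : ℕ} (ψ : Module.Dual ℂ (Form m e)) :
    ∃ F : Form m e, ∀ f : Form m e, apolarPairing m f F = ψ f := by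
  let B : Form m e →ₗ[ℂ] Module.Dual ℂ (Form m e) :=
    ((apolarPairing m).compl₁₂ (Submodule.subtype _) (Submodule.subtype _)).flip
  have hinj : Function.Injective B.flip := by
    rw [injective_iff_map_eq_zero]
    intro f hf
    ext1
    refine MvPolynomial.funext fun p => ?_
    have h := LinearMap.congr_fun hf ⟨pointLinearForm p ^ e, by
      simpa using (isHomogeneous_pointLinearForm p).pow e⟩
    have h2 : apolarPairing m f (pointLinearForm p ^ e) = 0 := h
    rw [apolarPairing_linearForm_pow (isHomogeneous_pointLinearForm _) f.2,
      linearFormPoint_pointLinearForm] at h2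
    simpa using (mul_eq_zero.1 h2).resolve_left (Nat.cast_ne_zero.2 (Nat.factorial_ne_zero _))
  obtain ⟨F, hF⟩ := LinearMap.flip_injective_iff₁.1 hinj ψ
  exact ⟨F, fun f => LinearMap.congr_fun hF f⟩

/-! ### The Waring rank -/

lemma exists_waring_decomposition {m d : ℕ} (F : Form m d) :
    ∃ (ℓ : Fin (m.multichoose d) → MvPolynomial (Fin m) ℂ) (c : Fin (m.multichoose d) → ℂ),
      (∀ i, (ℓ i).IsHomogeneous 1) ∧ (F : MvPolynomial (Fin m) ℂ) = ∑ i, c i • ℓ i ^ d := by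
  obtain ⟨p, hp⟩ := exists_form_eq_sum_smul_pow m d
  obtain ⟨b, hb⟩ := hp F
  exact ⟨_, b, fun i => isHomogeneous_pointLinearForm (p i), hb⟩

/-- Decompositions exist, so the infimum is attained and is not the default value 0 of `sInf ∅`. -/
lemma lt_waringRank {m d a : ℕ} (F : Form m d)
    (h : ∀ (r : ℕ) (ℓ : Fin r → MvPolynomial (Fin m) ℂ) (c : Fin r → ℂ),
      (∀ i, (ℓ i).IsHomogeneous 1) → (F : MvPolynomial (Fin m) ℂ) = ∑ i, c i • ℓ i ^ d → a < r) :
    a < waringRank d (F : MvPolynomial (Fin m) ℂ) := by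
  obtain ⟨ℓ, c, hℓ, hF⟩ := Nat.sInf_mem (s := {r : ℕ | ∃ (ℓ : Fin r → MvPolynomial (Fin m) ℂ)
    (c : Fin r → ℂ), (∀ i, (ℓ i).IsHomogeneous 1) ∧
      (F : MvPolynomial (Fin m) ℂ) = ∑ i, c i • ℓ i ^ d}) ⟨_, exists_waring_decomposition F⟩
  exact h _ ℓ c hℓ hF

lemma waringRank_le_maxWaringRank {m d : ℕ} (F : Form m d) :
    waringRank d (F : MvPolynomial (Fin m) ℂ) ≤ maxWaringRank m d := by
  refine le_csSup ⟨m.multichoose d, ?_⟩ ⟨F, rfl⟩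
  rintro _ ⟨F, rfl⟩
  exact Nat.sInf_le (exists_waring_decomposition F)

/-! ### Annihilators of a functional, degree by degree -/

section Perp

variable {m : ℕ}

/-- The forms `f` of degree `j` with `g (f * u) = 0` for all forms `u` of degree `e - j`. -/
def perp (g : Module.Dual ℂ (MvPolynomial (Fin m) ℂ)) (e j : ℕ) :
    Submodule ℂ (MvPolynomial (Fin m) ℂ) where
  carrier := {f | f.IsHomogeneous j ∧
    ∀ u : MvPolynomial (Fin m) ℂ, u.IsHomogeneous (e - j) → g (f * u) = 0}
  add_mem' := fun ha hb => ⟨ha.1.add hb.1, fun u hu => by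
    rw [add_mul, map_add, ha.2 u hu, hb.2 u hu, add_zero]⟩
  zero_mem' := ⟨isHomogeneous_zero _ _ _, fun u _ => by simp⟩
  smul_mem' := fun c f hf => ⟨by simpa [smul_eq_C_mul] using hf.1.C_mul c, fun u hu => by
    rw [smul_mul_assoc, map_smul, hf.2 u hu, smul_zero]⟩

lemma mem_perp {g : Module.Dual ℂ (MvPolynomial (Fin m) ℂ)} {e j : ℕ} {f : MvPolynomial (Fin m) ℂ} :
    f ∈ perp g e j ↔ f.IsHomogeneous j ∧
      ∀ u : MvPolynomial (Fin m) ℂ, u.IsHomogeneous (e - j) → g (f * u) = 0 := Iff.rfl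

lemma perp_le (g : Module.Dual ℂ (MvPolynomial (Fin m) ℂ)) (e j : ℕ) :
    perp g e j ≤ homogeneousSubmodule (Fin m) ℂ j := fun _ hf => hf.1

instance finiteDimensional_perp (g : Module.Dual ℂ (MvPolynomial (Fin m) ℂ)) (e j : ℕ) :
    FiniteDimensional ℂ (perp g e j) :=
  Submodule.finiteDimensional_of_le (perp_le g e j)

/-- The catalecticant of a functional, as a bilinear form on `S i × S j`. -/
noncomputable def catalecticant (g : Module.Dual ℂ (MvPolynomial (Fin m) ℂ)) (i j : ℕ) :
    Form m i →ₗ[ℂ] Module.Dual ℂ (Form m j) :=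
  (mulForm g).compl₁₂ (Submodule.subtype _) (Submodule.subtype _)

@[simp] lemma catalecticant_apply (g : Module.Dual ℂ (MvPolynomial (Fin m) ℂ)) (i j : ℕ)
    (f : Form m i) (u : Form m j) :
    catalecticant g i j f u = g ((f : MvPolynomial (Fin m) ℂ) * u) := rfl

/-- The annihilators in degrees j and e - j are the two kernels of one pairing; when one kernel
vanishes, the rank is the dimension on that side. -/
lemma finrank_perp_add {g : Module.Dual ℂ (MvPolynomial (Fin m) ℂ)} {e j : ℕ} (hj : j ≤ e)
    (h : perp g e (e - j) = ⊥) :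
    Module.finrank ℂ (perp g e j) + m.multichoose (e - j) = m.multichoose j := by
  have hflip : (catalecticant g j (e - j)).flip = catalecticant g (e - j) j := by
    ext u f
    simp [mul_comm]
  have hinj : Function.Injective (catalecticant g j (e - j)).flip := by
    rw [hflip, injective_iff_map_eq_zero]
    intro u hu
    have h1 : (u : MvPolynomial (Fin m) ℂ) ∈ perp g e (e - j) := by
      refine ⟨u.2, fun f hf => ?_⟩
      rw [Nat.sub_sub_self hj] at hf
      exact LinearMap.congr_fun hu ⟨f, hf⟩
    rw [h, Submodule.mem_bot] at h1
    exact Subtype.ext h1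
  have hsurj := LinearMap.flip_injective_iff₁.1 hinj
  have h1 := LinearMap.finrank_range_add_finrank_ker (catalecticant g j (e - j))
  have hker : LinearMap.ker (catalecticant g j (e - j)) =
      (perp g e j).submoduleOf (homogeneousSubmodule (Fin m) ℂ j) := by
    ext f
    rw [LinearMap.mem_ker, Submodule.submoduleOf, Submodule.mem_comap]
    constructor
    · exact fun hf => ⟨f.2, fun u hu => LinearMap.congr_fun hf ⟨u, hu⟩⟩
    · exact fun hf => LinearMap.ext fun u => hf.2 u u.2
  rw [LinearMap.range_eq_top.2 hsurj, finrank_top, Subspace.dual_finrank_eq, finrank_form,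
    hker, (Submodule.submoduleOfEquivOfLe (perp_le g e j)).finrank_eq, finrank_form] at h1
  omega

lemma exists_complement_perp (g : Module.Dual ℂ (MvPolynomial (Fin m) ℂ)) (e j : ℕ) :
    ∃ W : Submodule ℂ (MvPolynomial (Fin m) ℂ), W ≤ homogeneousSubmodule (Fin m) ℂ j ∧
      W ⊓ perp g e j = ⊥ ∧ W ⊔ perp g e j = homogeneousSubmodule (Fin m) ℂ j := by
  obtain ⟨C, hC⟩ := Submodule.exists_isCompl (perp g e j)
  -- The modular law makes the trace on forms of degree j of a complement in the whole ring a
  -- complement there.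
  refine ⟨C ⊓ homogeneousSubmodule (Fin m) ℂ j, inf_le_right, ?_, ?_⟩
  · rw [eq_bot_iff, ← hC.inf_eq_bot]
    exact le_inf inf_le_right (inf_le_left.trans inf_le_left)
  · rw [sup_comm, ← sup_inf_assoc_of_le _ (perp_le g e j), hC.sup_eq_top, top_inf_eq]

/-- A choice of complements of the annihilators of `g` in each degree. -/
structure PerpComplements (g : Module.Dual ℂ (MvPolynomial (Fin m) ℂ)) (e : ℕ)
    (W : ℕ → Submodule ℂ (MvPolynomial (Fin m) ℂ)) : Prop where
  le : ∀ j, W j ≤ homogeneousSubmodule (Fin m) ℂ j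
  inf_eq : ∀ j, W j ⊓ perp g e j = ⊥
  sup_eq : ∀ j, W j ⊔ perp g e j = homogeneousSubmodule (Fin m) ℂ j

lemma exists_perpComplements (g : Module.Dual ℂ (MvPolynomial (Fin m) ℂ)) (e : ℕ) :
    ∃ W, PerpComplements g e W := by
  choose W h1 h2 h3 using exists_complement_perp g e
  exact ⟨W, h1, h2, h3⟩

lemma finiteDimensional_of_le_homogeneousSubmodule {j : ℕ}
    {W : Submodule ℂ (MvPolynomial (Fin m) ℂ)} (h : W ≤ homogeneousSubmodule (Fin m) ℂ j) :
    FiniteDimensional ℂ W :=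
  Submodule.finiteDimensional_of_le h

namespace PerpComplements

variable {g : Module.Dual ℂ (MvPolynomial (Fin m) ℂ)} {e : ℕ}
  {W : ℕ → Submodule ℂ (MvPolynomial (Fin m) ℂ)}

lemma finrank_add (hW : PerpComplements g e W) (j : ℕ) :
    Module.finrank ℂ (W j) + Module.finrank ℂ (perp g e j) = m.multichoose j := by
  have := finiteDimensional_of_le_homogeneousSubmodule (hW.le j)
  have h := Submodule.finrank_sup_add_finrank_inf_eq (W j) (perp g e j)
  rw [hW.sup_eq, hW.inf_eq, finrank_bot, add_zero] at h
  rw [← h]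
  exact finrank_form m j

lemma eq_of_perp_eq_bot (hW : PerpComplements g e W) {j : ℕ} (h : perp g e j = ⊥) :
    W j = homogeneousSubmodule (Fin m) ℂ j := by
  rw [← hW.sup_eq j, h, sup_bot_eq]

lemma eq_zero (hW : PerpComplements g e W) {j : ℕ} {f : MvPolynomial (Fin m) ℂ} (h1 : f ∈ W j)
    (h2 : f ∈ perp g e j) : f = 0 := by
  have h : f ∈ W j ⊓ perp g e j := ⟨h1, h2⟩
  rwa [hW.inf_eq] at h

end PerpComplements

lemma sum_finrank_of_symmetric {k D : ℕ} {d : ℕ → ℕ}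
    (hlt : ∀ j < k, d j = m.multichoose j) (hk : d k = D)
    (hgt : ∀ j, k < j → j ≤ 2 * k → d j = m.multichoose (2 * k - j)) :
    ∑ j : Fin (2 * k + 1), d j = 2 * ∑ j ∈ range k, m.multichoose j + D := by
  rw [Fin.sum_univ_eq_sum_range d, show 2 * k + 1 = (k + 1) + k by ring, Finset.sum_range_add,
    Finset.sum_range_succ, hk, Finset.sum_congr rfl fun j hj => hlt j (Finset.mem_range.1 hj)]
  have h : ∑ x ∈ range k, d (k + 1 + x) = ∑ x ∈ range k, m.multichoose x := by
    rw [← Finset.sum_range_reflect]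
    refine Finset.sum_congr rfl fun x hx => ?_
    have := Finset.mem_range.1 hx
    rw [hgt _ (by omega) (by omega)]
    congr 1
    omega
  rw [h]
  ring

/-- The dimension of the product of the complements. -/
lemma PerpComplements.finrank_pi {g : Module.Dual ℂ (MvPolynomial (Fin m) ℂ)} {k : ℕ}
    {W : ℕ → Submodule ℂ (MvPolynomial (Fin m) ℂ)}
    (hW : PerpComplements g (2 * k) W) (hg : ∀ j < k, perp g (2 * k) j = ⊥)
    {W' : ℕ → Submodule ℂ (MvPolynomial (Fin m) ℂ)}
    (hle : ∀ j, W' j ≤ homogeneousSubmodule (Fin m) ℂ j)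
    (h : ∀ j ≠ k, W' j = W j) :
    Module.finrank ℂ (∀ j : Fin (2 * k + 1), W' j) =
      2 * ∑ j ∈ range k, m.multichoose j + Module.finrank ℂ (W' k) := by
  have (j : Fin (2 * k + 1)) : FiniteDimensional ℂ (W' j) :=
    finiteDimensional_of_le_homogeneousSubmodule (hle j)
  rw [Module.finrank_pi_fintype]
  refine sum_finrank_of_symmetric (d := fun j => Module.finrank ℂ (W' j)) ?_ rfl ?_
  · intro j hj
    rw [h j hj.ne, hW.eq_of_perp_eq_bot (hg j hj)]
    exact finrank_form m j
  · intro j h1 h2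
    rw [h j h1.ne']
    have h3 := hW.finrank_add j
    have h4 := finrank_perp_add h2 (hg (2 * k - j) (by omega))
    omega

/-- The sum map on a product of subspaces. -/
noncomputable def sumMap (W : ℕ → Submodule ℂ (MvPolynomial (Fin m) ℂ)) (M : ℕ) :
    (∀ j : Fin M, W j) →ₗ[ℂ] MvPolynomial (Fin m) ℂ :=
  ∑ j : Fin M, (W j).subtype ∘ₗ LinearMap.proj j

lemma sumMap_apply (W : ℕ → Submodule ℂ (MvPolynomial (Fin m) ℂ)) (M : ℕ)
    (w : ∀ j : Fin M, W j) : sumMap W M w = ∑ j, (w j : MvPolynomial (Fin m) ℂ) := by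
  simp [sumMap]

end Perp

/-! ### The apolar length of a form with nondegenerate middle catalecticant -/

/-- The expected apolar length of a general form of degree `2 * k` in `m` variables. -/
def expectedLength (m k : ℕ) : ℕ := 2 * ∑ j ∈ range k, m.multichoose j + m.multichoose k

lemma expectedLength_eq {n k : ℕ} (hn : 1 ≤ n) (hk : 1 ≤ k) :
    expectedLength (n - 1) k = (n + k - 2).choose (n - 1) + (n + k - 1).choose (n - 1) := by
  obtain ⟨m, rfl⟩ : ∃ m, n = m + 1 := ⟨n - 1, by omega⟩
  obtain ⟨l, rfl⟩ : ∃ l, k = l + 1 := ⟨k - 1, by omega⟩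
  have h1 := Nat.sum_range_multichoose l m
  have h2 := Nat.sum_range_multichoose (l + 1) m
  rw [Finset.sum_range_succ] at h2
  rw [expectedLength, Nat.add_sub_cancel, show m + 1 + (l + 1) - 2 = l + m by omega,
    show m + 1 + (l + 1) - 1 = l + 1 + m by omega, ← h1, ← h2]
  ring

lemma mulForm_eq_zero_of_mem_perp {m e i : ℕ} {g : Module.Dual ℂ (MvPolynomial (Fin m) ℂ)}
    (hg : ∀ j ≠ e, ∀ f : MvPolynomial (Fin m) ℂ, f.IsHomogeneous j → g f = 0)
    {f : MvPolynomial (Fin m) ℂ} (hf : f.IsHomogeneous i) (h : i ≤ e → f ∈ perp g e i) :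
    mulForm g f = 0 := by
  refine LinearMap.ext fun v => ?_
  rw [mulForm_apply, ← v.sum_homogeneousComponent, Finset.mul_sum, map_sum]
  refine Finset.sum_eq_zero fun l _ => ?_
  have hl := homogeneousComponent_isHomogeneous l v
  by_cases hil : i + l = e
  · exact (h (by omega)).2 _ (by rwa [show e - i = l by omega])
  · exact hg _ hil _ (hf.mul hl)

/-- Annihilators contribute nothing to the range, and on the sum of their complements `mulForm g` is
injective. The complements have the dimensions of all forms up to degree k and mirror them above. -/
lemma finrank_range_mulForm {m k : ℕ} {g : Module.Dual ℂ (MvPolynomial (Fin m) ℂ)}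
    (hg : ∀ j ≠ 2 * k, ∀ f : MvPolynomial (Fin m) ℂ, f.IsHomogeneous j → g f = 0)
    (hperp : ∀ j ≤ k, perp g (2 * k) j = ⊥) :
    Module.finrank ℂ (LinearMap.range (mulForm g)) = expectedLength m k := by
  obtain ⟨W, hW⟩ := exists_perpComplements g (2 * k)
  have hdim := hW.finrank_pi (fun j hj => hperp j hj.le) hW.le (fun _ _ => rfl)
  rw [hW.eq_of_perp_eq_bot (hperp k le_rfl)] at hdim
  have hfk := finrank_form m k
  rw [hfk] at hdim
  set T := mulForm g ∘ₗ sumMap W (2 * k + 1) with hT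
  have hinj : Function.Injective T := by
    rw [injective_iff_map_eq_zero]
    intro w hw
    ext j : 2
    refine hW.eq_zero (w j).2 ⟨hW.le _ (w j).2, fun u hu => ?_⟩
    have h1 := LinearMap.congr_fun hw u
    rw [hT, LinearMap.comp_apply, mulForm_apply, sumMap_apply, Finset.sum_mul, map_sum,
      Finset.sum_eq_single j] at h1
    · exact h1
    · intro i _ hij
      refine hg _ ?_ _ ((IsHomogeneous.mul (hW.le _ (w i).2) hu))
      have := j.2
      have : (i : ℕ) ≠ j := fun h => hij (Fin.ext h)
      omega
    · simp
  have hrange : LinearMap.range T = LinearMap.range (mulForm g) := by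
    apply le_antisymm
    · rw [hT]; exact LinearMap.range_comp_le_range _ _
    · rintro _ ⟨f, rfl⟩
      rw [← f.sum_homogeneousComponent, map_sum]
      refine Submodule.sum_mem _ fun i _ => ?_
      have hi := homogeneousComponent_isHomogeneous i f
      by_cases h2k : i ≤ 2 * k
      · have h1 : homogeneousComponent i f ∈ W i ⊔ perp g (2 * k) i := by
          rw [hW.sup_eq]; exact hi
        obtain ⟨w, hw, u, hu, hwu⟩ := Submodule.mem_sup.1 h1
        rw [← hwu, map_add, mulForm_eq_zero_of_mem_perp hg hu.1 fun _ => hu, add_zero]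
        refine ⟨Pi.single (⟨i, by omega⟩ : Fin (2 * k + 1)) (⟨w, hw⟩ : W i), ?_⟩
        rw [hT, LinearMap.comp_apply, sumMap_apply, Finset.sum_eq_single ⟨i, by omega⟩]
        · simp
        · intro j _ hj
          rw [Pi.single_eq_of_ne hj]; rfl
        · simp
      · rw [mulForm_eq_zero_of_mem_perp hg hi fun h => absurd h h2k]
        exact Submodule.zero_mem _
  rw [← hrange, LinearMap.finrank_range_of_inj hinj, hdim, expectedLength]

/-! ### Finite sets of points and apolar functionals -/

/-- The functional `∑ i, c i * f (x i)` attached to weighted points. -/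
noncomputable def weightedEval {m : ℕ} {ι : Type*} [Fintype ι] (x : ι → Fin m → ℂ) (c : ι → ℂ) :
    Module.Dual ℂ (MvPolynomial (Fin m) ℂ) :=
  ∑ i, c i • (MvPolynomial.aeval (x i)).toLinearMap

lemma weightedEval_apply {m : ℕ} {ι : Type*} [Fintype ι] (x : ι → Fin m → ℂ) (c : ι → ℂ)
    (f : MvPolynomial (Fin m) ℂ) : weightedEval x c f = ∑ i, c i * eval (x i) f := by
  simp [weightedEval, LinearMap.sum_apply, MvPolynomial.aeval_eq_eval]

/-- Evaluation of polynomials at finitely many points. -/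
noncomputable def pointsEval {m : ℕ} {ι : Type*} (x : ι → Fin m → ℂ) :
    MvPolynomial (Fin m) ℂ →ₗ[ℂ] ι → ℂ :=
  LinearMap.pi fun i => (MvPolynomial.aeval (x i)).toLinearMap

lemma pointsEval_apply {m : ℕ} {ι : Type*} (x : ι → Fin m → ℂ) (f : MvPolynomial (Fin m) ℂ)
    (i : ι) : pointsEval x f i = eval (x i) f := by
  simp [pointsEval, MvPolynomial.aeval_eq_eval]

lemma weightedEval_mul_eq_zero {m : ℕ} {ι : Type*} [Fintype ι] {x : ι → Fin m → ℂ} (c : ι → ℂ)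
    {f : MvPolynomial (Fin m) ℂ} (hf : pointsEval x f = 0) (u : MvPolynomial (Fin m) ℂ) :
    weightedEval x c (f * u) = 0 := by
  rw [weightedEval_apply]
  refine Finset.sum_eq_zero fun i _ => ?_
  rw [map_mul, ← pointsEval_apply, hf]
  simp

/-- Weighted points represent `g` if the functional they define vanishes in degrees below `e` and
agrees with `g` in degree `e`. -/
structure RepresentsAtPoints {m : ℕ} {ι : Type*} [Fintype ι] (x : ι → Fin m → ℂ) (c : ι → ℂ)
    (g : Module.Dual ℂ (MvPolynomial (Fin m) ℂ)) (e : ℕ) : Prop where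
  low : ∀ j < e, ∀ f : MvPolynomial (Fin m) ℂ, f.IsHomogeneous j → weightedEval x c f = 0
  top : ∀ f : MvPolynomial (Fin m) ℂ, f.IsHomogeneous e → weightedEval x c f = g f

section

variable {m : ℕ} {ι : Type*} [Fintype ι] {x : ι → Fin m → ℂ} {c : ι → ℂ}
  {g : Module.Dual ℂ (MvPolynomial (Fin m) ℂ)} {e : ℕ}

/-- The leading form of a polynomial vanishing at the points annihilates `g`. -/
lemma RepresentsAtPoints.leading_mem_perp (hx : RepresentsAtPoints x c g e)
    {f : ℕ → MvPolynomial (Fin m) ℂ} (hf : ∀ i, (f i).IsHomogeneous i) {j : ℕ} (hj : j ≤ e)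
    (h : pointsEval x (∑ i ∈ range (j + 1), f i) = 0) : f j ∈ perp g e j := by
  refine ⟨hf j, fun u hu => ?_⟩
  have h1 := weightedEval_mul_eq_zero c h u
  rw [Finset.sum_range_succ, add_mul, map_add, Finset.sum_mul, map_sum,
    Finset.sum_eq_zero, zero_add, hx.top] at h1
  · exact h1
  · have h2 := (hf j).mul hu
    rwa [Nat.add_sub_cancel' hj] at h2
  · intro i hi
    have := Finset.mem_range.1 hi
    exact hx.low _ (by omega) _ ((hf i).mul hu)

/-- Components in the complements that lie above degree `J` vanish. -/
lemma RepresentsAtPoints.components_eq_zero (hx : RepresentsAtPoints x c g e)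
    {W : ℕ → Submodule ℂ (MvPolynomial (Fin m) ℂ)} (hW : PerpComplements g e W)
    {f : ℕ → MvPolynomial (Fin m) ℂ} (hf : ∀ i, (f i).IsHomogeneous i) {J : ℕ} :
    ∀ {M : ℕ}, J ≤ M → M ≤ e + 1 → (∀ i, J ≤ i → i < M → f i ∈ W i) →
      pointsEval x (∑ i ∈ range M, f i) = 0 →
      pointsEval x (∑ i ∈ range J, f i) = 0 ∧ ∀ i, J ≤ i → i < M → f i = 0 := by
  intro M hJM
  induction M, hJM using Nat.le_induction with
  | base => exact fun _ _ h => ⟨h, fun i h1 h2 => absurd h2 (by omega)⟩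
  | succ M hJM ih =>
    intro hM hfW h
    have h1 : f M = 0 := hW.eq_zero (hfW M hJM (by omega)) (hx.leading_mem_perp hf (by omega) h)
    rw [Finset.sum_range_succ, h1, add_zero] at h
    obtain ⟨h2, h3⟩ := ih (by omega) (fun i hi hi' => hfW i hi (by omega)) h
    refine ⟨h2, fun i hi hi' => ?_⟩
    rcases Nat.lt_succ_iff_lt_or_eq.1 hi' with h4 | rfl
    · exact h3 i hi h4
    · exact h1

end

/-- Extension of a finite tuple of components by zero. -/
noncomputable def extendTuple {m : ℕ} {W : ℕ → Submodule ℂ (MvPolynomial (Fin m) ℂ)} {M : ℕ}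
    (w : ∀ j : Fin M, W j) (i : ℕ) : MvPolynomial (Fin m) ℂ :=
  if h : i < M then (w ⟨i, h⟩ : MvPolynomial (Fin m) ℂ) else 0

section

variable {m : ℕ} {W : ℕ → Submodule ℂ (MvPolynomial (Fin m) ℂ)} {M : ℕ}

lemma extendTuple_mem (w : ∀ j : Fin M, W j) (i : ℕ) : extendTuple w i ∈ W i := by
  unfold extendTuple
  split_ifs with h
  · exact (w ⟨i, h⟩).2
  · exact Submodule.zero_mem _

lemma sum_extendTuple (w : ∀ j : Fin M, W j) :
    ∑ i ∈ range M, extendTuple w i = sumMap W M w := by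
  rw [sumMap_apply, ← Fin.sum_univ_eq_sum_range]
  exact Finset.sum_congr rfl fun j _ => by simp [extendTuple]

lemma eq_zero_of_extendTuple {w : ∀ j : Fin M, W j} (h : ∀ i < M, extendTuple w i = 0) :
    w = 0 := by
  ext j : 2
  simpa [extendTuple] using h j j.2

end

/-! ### The consequence of a decomposition that is too short -/

/-- If a functional `K` extends a functional `g`, with annihilators as small as possible except for
one form `q` of degree `k`, and is represented with few points, then `K` is given by evaluation at
one point on the multiples of `q` by elements of the annihilator. -/
theorem exists_eq_eval_of_card_le {m k : ℕ} (hk : 1 ≤ k)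
    {g : Module.Dual ℂ (MvPolynomial (Fin m) ℂ)} (hperp : ∀ j < k, perp g (2 * k) j = ⊥)
    {q : MvPolynomial (Fin m) ℂ} (hq : perp g (2 * k) k = Submodule.span ℂ {q}) (hq0 : q ≠ 0)
    {ι κ : Type*} [Fintype ι] [Fintype κ] {x : ι → Fin m → ℂ} {c : ι → ℂ}
    {y : κ → Fin m → ℂ} {b : κ → ℂ} {K : Module.Dual ℂ (MvPolynomial (Fin m) ℂ)}
    (hx : RepresentsAtPoints x c g (2 * k))
    (hK : ∀ f : MvPolynomial (Fin m) ℂ, f.IsHomogeneous (2 * k + 1) →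
      weightedEval x c f + weightedEval y b f = K f)
    (hcard : Fintype.card ι + Fintype.card κ ≤ expectedLength m k) :
    ∃ (p : Fin m → ℂ) (t : ℂ), ∀ h ∈ perp g (2 * k) (k + 1),
      K (h * q) = t * (eval p h * eval p q) := by
  obtain ⟨W, hW⟩ := exists_perpComplements g (2 * k)
  have hqmem : q ∈ perp g (2 * k) k := hq ▸ Submodule.mem_span_singleton_self q
  have hqhom : q.IsHomogeneous k := hqmem.1
  have hWk : Module.finrank ℂ (W k) + 1 = m.multichoose k := by
    rw [← hW.finrank_add k, hq, finrank_span_singleton hq0]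
  -- The affine points number at least the target length minus one, the loss being the line spanned
  -- by q.
  have hcardι : 2 * ∑ j ∈ range k, m.multichoose j + Module.finrank ℂ (W k) ≤ Fintype.card ι := by
    rw [← hW.finrank_pi hperp hW.le (fun _ _ => rfl), ← Module.finrank_fintype_fun_eq_card ℂ]
    refine LinearMap.finrank_le_finrank_of_injective
      (f := pointsEval x ∘ₗ sumMap W (2 * k + 1)) ?_
    rw [injective_iff_map_eq_zero]
    intro w hw
    rw [LinearMap.comp_apply, ← sum_extendTuple] at hw
    refine eq_zero_of_extendTuple fun i hi => ?_
    exact (hx.components_eq_zero hW (fun i => hW.le i (extendTuple_mem w i)) (J := 0) (Nat.zero_le _)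
      le_rfl (fun i _ _ => extendTuple_mem w i) hw).2 i (Nat.zero_le _) hi
  -- The alternative: does some polynomial with leading form q vanish at all affine points?
  by_cases hA : ∃ f : ℕ → MvPolynomial (Fin m) ℂ, (∀ i, (f i).IsHomogeneous i) ∧
      pointsEval x (∑ i ∈ range k, f i + q) = 0
  · obtain ⟨f, hf, hfq⟩ := hA
    have hcardκ : Fintype.card κ ≤ 1 := by
      unfold expectedLength at hcard
      omega
    have hval : ∀ h ∈ perp g (2 * k) (k + 1), K (h * q) = weightedEval y b (h * q) := by
      intro h hh
      have h1 := weightedEval_mul_eq_zero c hfq h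
      rw [add_mul, map_add, Finset.sum_mul, map_sum, Finset.sum_eq_zero, zero_add] at h1
      · rw [← hK _ (by convert hh.1.mul hqhom using 1; omega), mul_comm h q, h1, zero_add]
      · intro i hi
        have hik := Finset.mem_range.1 hi
        -- Of the terms below q, only the one of degree k - 1 reaches degree 2k after multiplication
        -- by h, and there h annihilates it.
        by_cases hik' : i + 1 = k
        · rw [hx.top _ (by convert (hf i).mul hh.1 using 1; omega), mul_comm]
          exact hh.2 _ (by convert hf i using 1; omega)
        · exact hx.low _ (by omega) _ ((hf i).mul hh.1)
    rcases isEmpty_or_nonempty κ with hκ | ⟨⟨j⟩⟩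
    · refine ⟨0, 0, fun h hh => ?_⟩
      rw [hval h hh, weightedEval_apply]
      simp
    · have : Subsingleton κ := Fintype.card_le_one_iff_subsingleton.1 hcardκ
      refine ⟨y j, b j, fun h hh => ?_⟩
      rw [hval h hh, weightedEval_apply, Fintype.sum_subsingleton _ j, map_mul]
  -- Since q is not the leading form of a polynomial vanishing at the points, all forms of degree k
  -- may be admitted without losing injectivity of evaluation. The affine points then exhaust the
  -- allowed number.
  · set W' : ℕ → Submodule ℂ (MvPolynomial (Fin m) ℂ) :=
      Function.update W k (homogeneousSubmodule (Fin m) ℂ k) with hW'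
    have hne : ∀ j ≠ k, W' j = W j := fun j hj => Function.update_of_ne hj _ _
    have hW'k : W' k = homogeneousSubmodule (Fin m) ℂ k := Function.update_self _ _ _
    have hle : ∀ j, W' j ≤ homogeneousSubmodule (Fin m) ℂ j := by
      intro j
      rcases eq_or_ne j k with rfl | hj
      · exact hW'k.le
      · rw [hne j hj]; exact hW.le j
    have hdim : Module.finrank ℂ (∀ j : Fin (2 * k + 1), W' j) = expectedLength m k := by
      rw [hW.finrank_pi hperp hle hne, hW'k, expectedLength]
      congr 1
      exact finrank_form m k
    have hinj : Function.Injective (pointsEval x ∘ₗ sumMap W' (2 * k + 1)) := by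
      rw [injective_iff_map_eq_zero]
      intro w hw
      rw [LinearMap.comp_apply, ← sum_extendTuple] at hw
      have hhom : ∀ i, (extendTuple w i).IsHomogeneous i := fun i => hle i (extendTuple_mem w i)
      have hmem : ∀ i ≠ k, extendTuple w i ∈ W i := fun i hi => by
        rw [← hne i hi]; exact extendTuple_mem w i
      obtain ⟨h1, h2⟩ := hx.components_eq_zero hW hhom (J := k + 1) (by omega) le_rfl
        (fun i hi _ => hmem i (by omega)) hw
      have h3 : extendTuple w k ∈ perp g (2 * k) k := hx.leading_mem_perp hhom (by omega) h1
      have h4 : extendTuple w k = 0 := by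
        rw [hq, Submodule.mem_span_singleton] at h3
        obtain ⟨a, ha⟩ := h3
        rw [← ha]
        rcases eq_or_ne a 0 with rfl | ha0
        · simp
        · refine absurd ⟨fun i => a⁻¹ • extendTuple w i, fun i => ?_, ?_⟩ hA
          · simpa [smul_eq_C_mul] using (hhom i).C_mul a⁻¹
          · rw [Finset.sum_range_succ, ← ha] at h1
            have h5 : ∑ i ∈ range k, a⁻¹ • extendTuple w i + q =
                a⁻¹ • (∑ i ∈ range k, extendTuple w i + a • q) := by
              rw [smul_add, inv_smul_smul₀ ha0, Finset.smul_sum]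
            rw [h5, map_smul, h1, smul_zero]
      rw [Finset.sum_range_succ, h4, add_zero] at h1
      have h5 := (hx.components_eq_zero hW hhom (J := 0) (Nat.zero_le _) (by omega)
        (fun i _ hi => hmem i (by omega)) h1).2
      refine eq_zero_of_extendTuple fun i hi => ?_
      rcases lt_trichotomy i k with h | rfl | h
      · exact h5 i (Nat.zero_le _) h
      · exact h4
      · exact h2 i h hi
    have hcard' : expectedLength m k ≤ Fintype.card ι := by
      rw [← hdim, ← Module.finrank_fintype_fun_eq_card ℂ]
      exact LinearMap.finrank_le_finrank_of_injective hinj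
    have hκ : IsEmpty κ := Fintype.card_eq_zero_iff.1 (by omega)
    have : ∀ j : Fin (2 * k + 1), FiniteDimensional ℂ (W' j) :=
      fun j => finiteDimensional_of_le_homogeneousSubmodule (hle j)
    have hsurj : Function.Surjective (pointsEval x ∘ₗ sumMap W' (2 * k + 1)) := by
      refine (LinearMap.injective_iff_surjective_of_finrank_eq_finrank ?_).1 hinj
      rw [hdim, Module.finrank_fintype_fun_eq_card]
      omega
    -- Here K(hq) = 0: h will be replaced on the points by an interpolant w of degree at most k,
    -- whose products with q are killed by the functional.
    refine ⟨0, 0, fun h hh => ?_⟩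
    rw [zero_mul]
    obtain ⟨w, hw⟩ := hsurj (pointsEval x h)
    rw [LinearMap.comp_apply, ← sum_extendTuple] at hw
    have hhom : ∀ i, (extendTuple w i).IsHomogeneous i := fun i => hle i (extendTuple_mem w i)
    have hmem : ∀ i ≠ k, extendTuple w i ∈ W i := fun i hi => by
      rw [← hne i hi]; exact extendTuple_mem w i
    set f : ℕ → MvPolynomial (Fin m) ℂ := fun i => extendTuple w i - if i = k + 1 then h else 0
      with hf
    have hfhom : ∀ i, (f i).IsHomogeneous i := by
      intro i
      refine (hhom i).sub ?_
      split_ifs with hi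
      · rw [hi]; exact hh.1
      · exact isHomogeneous_zero _ _ _
    have hfsum : pointsEval x (∑ i ∈ range (2 * k + 1), f i) = 0 := by
      rw [hf, Finset.sum_sub_distrib, Finset.sum_ite_eq', if_pos (Finset.mem_range.2 (by omega)),
        map_sub, hw, sub_self]
    obtain ⟨h1, -⟩ := hx.components_eq_zero hW hfhom (J := k + 2) (by omega) le_rfl
      (fun i hi _ => by
        simp only [hf]
        rw [if_neg (by omega), sub_zero]
        exact hmem i (by omega)) hfsum
    have h2 : f (k + 1) ∈ perp g (2 * k) (k + 1) := hx.leading_mem_perp hfhom (by omega) h1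
    -- The difference of w and h has leading form in the annihilator, and so does h; hence the
    -- degree k + 1 component of w lies in the annihilator and in its complement.
    have h3 : extendTuple w (k + 1) = 0 := by
      refine hW.eq_zero (hmem _ (by omega)) ?_
      simp only [hf, if_true] at h2
      simpa using Submodule.add_mem _ h2 hh
    rw [Finset.sum_range_succ] at h1
    have h4 : ∑ i ∈ range (k + 1), f i = ∑ i ∈ range (k + 1), extendTuple w i := by
      refine Finset.sum_congr rfl fun i hi => ?_
      have := Finset.mem_range.1 hi
      simp only [hf]
      rw [if_neg (by omega), sub_zero]
    rw [h4] at h1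
    simp only [hf, if_true, h3, zero_sub] at h1
    have h5 := weightedEval_mul_eq_zero c h1 q
    rw [add_mul, map_add, neg_mul, map_neg, ← sub_eq_add_neg, sub_eq_zero] at h5
    rw [← hK _ (by convert hh.1.mul hqhom using 1; omega), weightedEval_apply y, ← h5,
      Finset.sum_mul, map_sum]
    simp only [Finset.univ_eq_empty, Finset.sum_empty, add_zero]
    refine Finset.sum_eq_zero fun i hi => ?_
    have hik := Finset.mem_range.1 hi
    rcases eq_or_ne i k with rfl | hik'
    · rw [hx.top _ (by convert (hhom i).mul hqhom using 1; omega), mul_comm]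
      exact hqmem.2 _ (by convert hhom i using 1; omega)
    · exact hx.low _ (by omega) _ ((hhom i).mul hqhom)

/-! ### Waring decompositions of `X 0 * G + K` -/

lemma apolarPairing_comm {m : ℕ} (Θ F : MvPolynomial (Fin m) ℂ) :
    apolarPairing m Θ F = apolarPairing m F Θ := by
  suffices h : apolarPairing m = (apolarPairing m).flip from LinearMap.congr_fun₂ h Θ F
  refine linearMap_ext_monomial fun a => linearMap_ext_monomial fun b => ?_
  rw [LinearMap.flip_apply, apolarPairing_monomial, apolarPairing_monomial]
  rcases eq_or_ne a b with rfl | h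
  · rfl
  · classical
    rw [coeff_monomial, coeff_monomial, if_neg h, if_neg h.symm, mul_zero, mul_zero]

lemma pderiv_zero_rename_succ {m : ℕ} (f : MvPolynomial (Fin m) ℂ) :
    pderiv 0 (rename Fin.succ f) = 0 := by
  classical
  refine pderiv_eq_zero_of_notMem_vars fun h => ?_
  obtain ⟨i, -, hi⟩ := Finset.mem_image.1 (vars_rename _ _ h)
  exact Fin.succ_ne_zero i hi

lemma exponentFactorial_mapDomain_succ {m : ℕ} (a : Fin m →₀ ℕ) :
    exponentFactorial (a.mapDomain Fin.succ) = exponentFactorial a := by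
  unfold exponentFactorial
  rw [Fin.prod_univ_succ, Finsupp.mapDomain_of_notMem_range _ _ (by simp)]
  simp [Finsupp.mapDomain_apply (Fin.succ_injective m)]

lemma apolarPairing_rename_succ {m : ℕ} (f F : MvPolynomial (Fin m) ℂ) :
    apolarPairing (m + 1) (rename Fin.succ f) (rename Fin.succ F) = apolarPairing m f F := by
  suffices h : (apolarPairing (m + 1)).flip (rename Fin.succ F) ∘ₗ
      (rename (R := ℂ) (Fin.succ (n := m))).toLinearMap = (apolarPairing m).flip F from
    LinearMap.congr_fun h f
  refine linearMap_ext_monomial fun a => ?_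
  simp only [LinearMap.comp_apply, LinearMap.flip_apply, AlgHom.toLinearMap_apply, rename_monomial,
    apolarPairing_monomial, exponentFactorial_mapDomain_succ]
  rw [coeff_rename_mapDomain _ (Fin.succ_injective m)]

/-- The form `X 0 * G + K`, with `G` and `K` in the last `m` variables. -/
noncomputable def coneForm {m : ℕ} (G K : MvPolynomial (Fin m) ℂ) :
    MvPolynomial (Fin (m + 1)) ℂ :=
  X 0 * rename Fin.succ G + rename Fin.succ K

lemma isHomogeneous_coneForm {m e : ℕ} {G K : MvPolynomial (Fin m) ℂ} (hG : G.IsHomogeneous e)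
    (hK : K.IsHomogeneous (e + 1)) : (coneForm G K).IsHomogeneous (e + 1) := by
  refine IsHomogeneous.add ?_ hK.rename_isHomogeneous
  rw [add_comm e 1]
  exact (isHomogeneous_X _ _).mul hG.rename_isHomogeneous

lemma pderiv_zero_coneForm {m : ℕ} (G K : MvPolynomial (Fin m) ℂ) :
    pderiv 0 (coneForm G K) = rename Fin.succ G := by
  simp [coneForm, pderiv_zero_rename_succ]

lemma apolarPairing_coneForm {m : ℕ} (f G K : MvPolynomial (Fin m) ℂ) :
    apolarPairing (m + 1) (rename Fin.succ f) (coneForm G K) = apolarPairing m f K := by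
  rw [coneForm, map_add, apolarPairing_rename_succ, apolarPairing_comm, mul_comm,
    apolarPairing_mul_X, pderiv_zero_rename_succ, map_zero, zero_add]

lemma apolarPairing_mul_X_coneForm {m : ℕ} (f G K : MvPolynomial (Fin m) ℂ) :
    apolarPairing (m + 1) (rename Fin.succ f * X 0) (coneForm G K) = apolarPairing m f G := by
  rw [apolarPairing_mul_X, pderiv_zero_coneForm, apolarPairing_rename_succ]

lemma apolarPairing_mul_X_pow_coneForm {m : ℕ} (f G K : MvPolynomial (Fin m) ℂ) (e : ℕ) :
    apolarPairing (m + 1) (rename Fin.succ f * X 0 ^ (e + 2)) (coneForm G K) = 0 := by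
  rw [pow_succ, pow_succ, ← mul_assoc, ← mul_assoc, apolarPairing_mul_X, pderiv_zero_coneForm,
    apolarPairing_mul_X, pderiv_zero_rename_succ, map_zero]

/-- A Waring decomposition of `X 0 * G + K` yields weighted points representing `G` and `K`. -/
lemma exists_points_of_coneForm_eq {m e r : ℕ} {G K : MvPolynomial (Fin m) ℂ}
    {ℓ : Fin r → MvPolynomial (Fin (m + 1)) ℂ} {c : Fin r → ℂ} (hℓ : ∀ i, (ℓ i).IsHomogeneous 1)
    (h : coneForm G K = ∑ i, c i • ℓ i ^ (e + 1)) :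
    ∃ (ι κ : Type) (_ : Fintype ι) (_ : Fintype κ) (x : ι → Fin m → ℂ) (w : ι → ℂ)
      (y : κ → Fin m → ℂ) (b : κ → ℂ), Fintype.card ι + Fintype.card κ = r ∧
      RepresentsAtPoints x w ((apolarPairing m).flip G) e ∧
      ∀ f : MvPolynomial (Fin m) ℂ, f.IsHomogeneous (e + 1) →
        weightedEval x w f + weightedEval y b f = apolarPairing m f K := by
  classical
  let a : Fin r → ℂ := fun i => linearFormPoint (ℓ i) 0
  let v : Fin r → Fin m → ℂ := fun i j => linearFormPoint (ℓ i) j.succ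
  let N : ℂ := ((e + 1).factorial : ℂ)
  -- Dehomogenisation: an evaluation in degree j at `v i` rescales by `a i ^ j`, and with the factor
  -- `a i ^ l`, j + l = e + 1, the weight no longer depends on j.
  let x : {i // a i ≠ 0} → Fin m → ℂ := fun i => (a i)⁻¹ • v i
  let w : {i // a i ≠ 0} → ℂ := fun i => N * c i * a i ^ (e + 1)
  let y : {i // ¬ a i ≠ 0} → Fin m → ℂ := fun i => v i
  let b : {i // ¬ a i ≠ 0} → ℂ := fun i => N * c i
  have hpair : ∀ (j l : ℕ), j + l = e + 1 → ∀ f : MvPolynomial (Fin m) ℂ, f.IsHomogeneous j →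
      apolarPairing (m + 1) (rename Fin.succ f * X 0 ^ l) (coneForm G K) =
        ∑ i, N * c i * a i ^ l * eval (v i) f := by
    intro j l hjl f hf
    have hΘ : (rename Fin.succ f * X 0 ^ l : MvPolynomial (Fin (m + 1)) ℂ).IsHomogeneous (e + 1) :=
      hjl ▸ hf.rename_isHomogeneous.mul (isHomogeneous_X_pow _ _)
    rw [h, map_sum]
    refine Finset.sum_congr rfl fun i _ => ?_
    rw [map_smul, apolarPairing_linearForm_pow (hℓ i) hΘ, map_mul, eval_rename, map_pow, eval_X,
      smul_eq_mul]
    simp only [N, a, v, Function.comp_def]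
    ring
  have hsum : ∀ (j l : ℕ), j + l = e + 1 → ∀ f : MvPolynomial (Fin m) ℂ, f.IsHomogeneous j →
      weightedEval x w f + ∑ i : {i // ¬ a i ≠ 0}, N * c i * a i ^ l * eval (v i) f =
        apolarPairing (m + 1) (rename Fin.succ f * X 0 ^ l) (coneForm G K) := by
    intro j l hjl f hf
    rw [hpair j l hjl f hf, ← Fintype.sum_subtype_add_sum_subtype (fun i => a i ≠ 0),
      weightedEval_apply]
    congr 1
    refine Finset.sum_congr rfl fun i _ => ?_
    simp only [x, w]
    rw [eval_smul_of_isHomogeneous hf, ← hjl, pow_add, inv_pow]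
    have := pow_ne_zero j i.2
    field_simp
  have hzero : ∀ (l : ℕ), l ≠ 0 → ∀ f : MvPolynomial (Fin m) ℂ,
      ∑ i : {i // ¬ a i ≠ 0}, N * c i * a i ^ l * eval (v i) f = 0 := fun l hl f =>
    Finset.sum_eq_zero fun i _ => by rw [not_not.1 i.2, zero_pow hl, mul_zero, zero_mul]
  -- Pairing with f times `X 0 ^ l`: l ≥ 2 gives zero, l = 1 sees G, l = 0 sees K. The points at
  -- infinity enter only for l = 0.
  refine ⟨_, _, inferInstance, inferInstance, x, w, y, b, ?_, ⟨?_, ?_⟩, ?_⟩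
  · rw [← Fintype.card_sum, Fintype.card_congr (Equiv.sumCompl fun i => a i ≠ 0), Fintype.card_fin]
  · intro j hj f hf
    obtain ⟨l, rfl⟩ : ∃ l, e = j + 1 + l := ⟨e - (j + 1), by omega⟩
    have h1 := hsum j (l + 2) (by omega) f hf
    rwa [hzero _ (by omega), add_zero, apolarPairing_mul_X_pow_coneForm] at h1
  · intro f hf
    have h1 := hsum e 1 rfl f hf
    rwa [hzero _ one_ne_zero, add_zero, pow_one, apolarPairing_mul_X_coneForm] at h1
  · intro f hf
    have h1 := hsum (e + 1) 0 rfl f hf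
    rw [pow_zero, mul_one, apolarPairing_coneForm] at h1
    rw [← h1, weightedEval_apply y]
    simp [y, b]

/-! ### Sums of powers and their catalecticants -/

lemma apolarPairing_sum_pow {m e : ℕ} {ι : Type*} [Fintype ι] {ℓ : ι → MvPolynomial (Fin m) ℂ}
    (hℓ : ∀ i, (ℓ i).IsHomogeneous 1) {Θ : MvPolynomial (Fin m) ℂ} (hΘ : Θ.IsHomogeneous e) :
    apolarPairing m Θ (∑ i, ℓ i ^ e) =
      (e.factorial : ℂ) * ∑ i, eval (linearFormPoint (ℓ i)) Θ := by
  rw [map_sum, Finset.mul_sum]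
  exact Finset.sum_congr rfl fun i _ => apolarPairing_linearForm_pow (hℓ i) hΘ

/-- Pairing f u with the sum of powers gives, up to a factorial, the sum of f(p_i) u(p_i), and u can
be chosen to single out one point. -/
lemma mem_perp_sum_pow_iff {m k : ℕ} {ι : Type*} [Fintype ι] {ℓ : ι → MvPolynomial (Fin m) ℂ}
    (hℓ : ∀ i, (ℓ i).IsHomogeneous 1)
    (hsurj : Function.Surjective (formEval k fun i => linearFormPoint (ℓ i)))
    {f : MvPolynomial (Fin m) ℂ} (hf : f.IsHomogeneous k) :
    f ∈ perp ((apolarPairing m).flip (∑ i, ℓ i ^ (2 * k))) (2 * k) k ↔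
      ∀ i, eval (linearFormPoint (ℓ i)) f = 0 := by
  classical
  rw [mem_perp, and_iff_right hf, show 2 * k - k = k by omega]
  have hval : ∀ u : MvPolynomial (Fin m) ℂ, u.IsHomogeneous k →
      (apolarPairing m).flip (∑ i, ℓ i ^ (2 * k)) (f * u) =
        ((2 * k).factorial : ℂ) * ∑ i, eval (linearFormPoint (ℓ i)) f *
          eval (linearFormPoint (ℓ i)) u := by
    intro u hu
    rw [LinearMap.flip_apply, apolarPairing_sum_pow hℓ (by convert hf.mul hu using 1; omega)]
    simp
  constructor
  · intro h i
    obtain ⟨u, hu⟩ := hsurj (Pi.single i 1)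
    have h1 := h u u.2
    rw [hval u u.2] at h1
    have h2 : ∀ j, eval (linearFormPoint (ℓ j)) (u : MvPolynomial (Fin m) ℂ) =
        (Pi.single i 1 : ι → ℂ) j := fun j => by
      rw [← hu, formEval_apply]
    simp only [h2, Pi.single_apply, mul_ite, mul_one, mul_zero, Finset.sum_ite_eq',
      Finset.mem_univ, if_true, mul_eq_zero] at h1
    exact h1.resolve_left (Nat.cast_ne_zero.2 (Nat.factorial_ne_zero _))
  · intro h u hu
    rw [hval u hu]
    simp [h]

lemma mul_mem_perp {m e i j : ℕ} {g : Module.Dual ℂ (MvPolynomial (Fin m) ℂ)}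
    {f u : MvPolynomial (Fin m) ℂ} (hf : f ∈ perp g e j) (hu : u.IsHomogeneous i) (h : j + i ≤ e) :
    f * u ∈ perp g e (j + i) := by
  refine ⟨hf.1.mul hu, fun v hv => ?_⟩
  rw [mul_assoc]
  exact hf.2 _ (by convert hu.mul hv using 1; omega)

lemma perp_eq_bot_of_lt {m k j : ℕ} {g : Module.Dual ℂ (MvPolynomial (Fin m) ℂ)} (hm : 1 ≤ m)
    (h : perp g (2 * k) k = ⊥) (hj : j ≤ k) : perp g (2 * k) j = ⊥ := by
  rw [eq_bot_iff]
  intro f hf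
  have h1 := mul_mem_perp hf (isHomogeneous_X_pow (⟨0, hm⟩ : Fin m) (k - j)) (by omega)
  rw [show j + (k - j) = k by omega, h, Submodule.mem_bot, mul_eq_zero] at h1
  exact h1.resolve_right (pow_ne_zero _ (X_ne_zero _))

/-- A nonzero f in lower degree would make f X_0^(k-j) and f X_1^(k-j) both multiples of q, hence
proportional; two variables are needed for this to be absurd. -/
lemma perp_eq_bot_of_span {m k j : ℕ} {g : Module.Dual ℂ (MvPolynomial (Fin m) ℂ)} (hm : 2 ≤ m)
    {q : MvPolynomial (Fin m) ℂ} (h : perp g (2 * k) k = Submodule.span ℂ {q}) (hj : j < k) :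
    perp g (2 * k) j = ⊥ := by
  rw [eq_bot_iff]
  intro f hf
  rw [Submodule.mem_bot]
  by_contra hf0
  have hmul : ∀ i : Fin m, ∃ a : ℂ, a • q = f * X i ^ (k - j) := by
    intro i
    have h1 := mul_mem_perp hf (isHomogeneous_X_pow i (k - j)) (by omega)
    rwa [show j + (k - j) = k by omega, h, Submodule.mem_span_singleton] at h1
  obtain ⟨a, ha⟩ := hmul ⟨0, by omega⟩
  obtain ⟨b, hb⟩ := hmul ⟨1, by omega⟩
  have hX : ∀ i : Fin m, f * X i ^ (k - j) ≠ 0 := fun i =>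
    mul_ne_zero hf0 (pow_ne_zero _ (X_ne_zero _))
  have hb0 : b ≠ 0 := by
    rintro rfl
    exact hX _ (by rw [← hb, zero_smul])
  have h1 : f * (b • X ⟨0, by omega⟩ ^ (k - j)) = f * (a • X ⟨1, by omega⟩ ^ (k - j)) := by
    rw [mul_smul_comm, mul_smul_comm, ← ha, ← hb, smul_comm]
  have h2 := congrArg (eval (Pi.single (⟨0, by omega⟩ : Fin m) (1 : ℂ))) (mul_left_cancel₀ hf0 h1)
  simp [smul_eq_C_mul, zero_pow (show k - j ≠ 0 by omega)] at h2
  exact hb0 h2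

lemma apolarFunctional_eq_zero {m e : ℕ} {F : MvPolynomial (Fin m) ℂ} (hF : F.IsHomogeneous e) :
    ∀ j ≠ e, ∀ f : MvPolynomial (Fin m) ℂ, f.IsHomogeneous j →
      (apolarPairing m).flip F f = 0 := by
  intro j hj f hf
  rw [LinearMap.flip_apply]
  exact apolarPairing_eq_zero_of_degree_ne hf hF hj

/-! ### General forms and general tuples of linear forms -/

lemma catalecticant_nondegenerate_iff {m k : ℕ} (g : Module.Dual ℂ (MvPolynomial (Fin m) ℂ)) :
    LinearMap.BilinForm.Nondegenerate (catalecticant g k k) ↔ perp g (2 * k) k = ⊥ := by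
  constructor
  · intro h
    rw [eq_bot_iff]
    intro f hf
    have h1 := h.1 ⟨f, hf.1⟩ fun u => hf.2 u (by rw [show 2 * k - k = k by omega]; exact u.2)
    exact congrArg Subtype.val h1
  · intro h
    have hleft : LinearMap.SeparatingLeft (catalecticant g k k) := by
      intro f hf
      have h1 : (f : MvPolynomial (Fin m) ℂ) ∈ perp g (2 * k) k :=
        ⟨f.2, fun u hu => hf ⟨u, by rw [show 2 * k - k = k by omega] at hu; exact hu⟩⟩
      rw [h, Submodule.mem_bot] at h1
      exact Subtype.ext h1
    refine ⟨hleft, fun f hf => hleft f fun u => ?_⟩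
    rw [← hf u, catalecticant_apply, catalecticant_apply, mul_comm]

theorem holdsForGeneral_apolarLength {m : ℕ} (hm : 1 ≤ m) (k : ℕ) :
    HoldsForGeneral (Form m (2 * k))
      fun H => apolarLength (H : MvPolynomial (Fin m) ℂ) = expectedLength m k := by
  classical
  let b := Module.finBasis ℂ (Form m k)
  let M : Form m (2 * k) → Matrix _ _ ℂ := fun H => LinearMap.BilinForm.toMatrix b
    (catalecticant ((apolarPairing m).flip (H : MvPolynomial (Fin m) ℂ)) k k)
  have hM : ∀ H : Form m (2 * k), (M H).det ≠ 0 ↔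
      perp ((apolarPairing m).flip (H : MvPolynomial (Fin m) ℂ)) (2 * k) k = ⊥ := fun H => by
    rw [← LinearMap.BilinForm.nondegenerate_iff_det_ne_zero, catalecticant_nondegenerate_iff]
  refine ⟨fun H => (M H).det, det_mem_polynomialFunctionAlgebra fun i j => ?_, ?_, fun H hH => ?_⟩
  · simp only [M, LinearMap.BilinForm.toMatrix_apply, catalecticant_apply, LinearMap.flip_apply]
    exact dual_mem_polynomialFunctionAlgebra
      (apolarPairing m ((b i : MvPolynomial (Fin m) ℂ) * b j) ∘ₗ Submodule.subtype _)
  -- The determinant is nonzero at a sum of dim S_k powers whose points are in general position: a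
  -- form of degree k vanishing at all of them is zero.
  · obtain ⟨p, hp⟩ := exists_formEval_surjective (m := m) (e := k) le_rfl
    have hinj : Function.Injective (formEval k p) :=
      (LinearMap.injective_iff_surjective_of_finrank_eq_finrank
        (by rw [finrank_form, Module.finrank_fin_fun])).2 hp
    have hℓ := fun i => isHomogeneous_pointLinearForm (p i)
    refine ⟨⟨∑ i, pointLinearForm (p i) ^ (2 * k), IsHomogeneous.sum _ _ _ fun i _ => by
      simpa using (hℓ i).pow (2 * k)⟩, (hM _).2 ?_⟩
    rw [eq_bot_iff]
    intro f hf
    have h1 := (mem_perp_sum_pow_iff hℓ (by simpa using hp) hf.1).1 hf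
    have h2 : (⟨f, hf.1⟩ : Form m k) = 0 := hinj (by ext i; simpa using h1 i)
    exact congrArg Subtype.val h2
  · change apolarLength (H : MvPolynomial (Fin m) ℂ) = expectedLength m k
    rw [apolarLength_eq_finrank_range]
    exact finrank_range_mulForm (apolarFunctional_eq_zero H.2)
      fun j hj => perp_eq_bot_of_lt hm ((hM H).1 hH) hj

theorem generalApolarLength_eq {m : ℕ} (hm : 1 ≤ m) (k : ℕ) :
    generalApolarLength m (2 * k) = expectedLength m k := by
  have h : {a : ℕ | HoldsForGeneral (Form m (2 * k))
      fun H => apolarLength (H : MvPolynomial (Fin m) ℂ) = a} = {expectedLength m k} := by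
    ext a
    constructor
    · intro ha
      obtain ⟨H, h1, h2⟩ := HoldsForGeneral.exists_and ha (holdsForGeneral_apolarLength hm k)
      exact h1.symm.trans h2
    · rintro rfl
      exact holdsForGeneral_apolarLength hm k
  unfold generalApolarLength
  rw [h, csInf_singleton]

/-- General linear forms impose independent conditions on forms of degree `e`. -/
lemma holdsForGeneral_formEval_surjective {m e s : ℕ} (hs : s ≤ m.multichoose e) :
    HoldsForGeneral (Fin s → Form m 1) fun ℓ => Function.Surjective
      (formEval e fun i => linearFormPoint (ℓ i : MvPolynomial (Fin m) ℂ)) := by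
  classical
  obtain ⟨p, hp⟩ := exists_formEval_surjective hs
  choose u hu using fun j : Fin s => hp (Pi.single j 1)
  -- The forms `u j` are dual to one good tuple of points, so the matrix is the identity there;
  -- where it is invertible, the `u j` still interpolate arbitrary values.
  let M : (Fin s → Form m 1) → Matrix (Fin s) (Fin s) ℂ := fun ℓ => Matrix.of fun i j =>
    eval (linearFormPoint (ℓ i : MvPolynomial (Fin m) ℂ)) (u j : MvPolynomial (Fin m) ℂ)
  refine ⟨fun ℓ => (M ℓ).det, det_mem_polynomialFunctionAlgebra fun i j => ?_, ?_, fun ℓ hℓ => ?_⟩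
  · refine eval_mem_polynomialFunctionAlgebra (fun t => ?_) _
    exact dual_mem_polynomialFunctionAlgebra
      (MvPolynomial.lcoeff ℂ (Finsupp.single t 1) ∘ₗ (homogeneousSubmodule (Fin m) ℂ 1).subtype ∘ₗ
        LinearMap.proj (φ := fun _ : Fin s => Form m 1) i)
  · refine ⟨fun i => ⟨pointLinearForm (p i), isHomogeneous_pointLinearForm (p i)⟩, ?_⟩
    have h1 : M (fun i => ⟨pointLinearForm (p i), isHomogeneous_pointLinearForm (p i)⟩) = 1 := by
      ext i j
      have h2 := congrFun (hu j) i
      rw [formEval_apply] at h2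
      simp only [M, Matrix.of_apply, linearFormPoint_pointLinearForm, h2, Matrix.one_apply,
        Pi.single_apply]
    change Matrix.det (M _) ≠ 0
    rw [h1, Matrix.det_one]
    exact one_ne_zero
  · intro w
    set v := (M ℓ)⁻¹.mulVec w with hv
    refine ⟨∑ j, v j • u j, ?_⟩
    have h1 : (M ℓ).mulVec v = w := by
      rw [hv, Matrix.mulVec_mulVec, Matrix.mul_nonsing_inv _ (isUnit_iff_ne_zero.2 hℓ),
        Matrix.one_mulVec]
    ext i
    rw [← congrFun h1 i, map_sum, Finset.sum_apply]
    simp only [Matrix.mulVec, dotProduct]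
    refine Finset.sum_congr rfl fun j _ => ?_
    rw [map_smul, Pi.smul_apply, formEval_apply, smul_eq_mul, mul_comm]
    rfl

/-! ### Forms `X 0 * G + K` of large Waring rank -/

lemma exists_ker_eq_span {V W : Type*} [AddCommGroup V] [Module ℂ V] [FiniteDimensional ℂ V]
    [AddCommGroup W] [Module ℂ W] {L : V →ₗ[ℂ] W} (hL : Function.Surjective L)
    (h : Module.finrank ℂ W + 1 = Module.finrank ℂ V) :
    ∃ q : V, q ≠ 0 ∧ L q = 0 ∧ ∀ f, L f = 0 → ∃ a : ℂ, a • q = f := by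
  have h1 := LinearMap.finrank_range_add_finrank_ker L
  rw [LinearMap.range_eq_top.2 hL, finrank_top, ← h, add_right_inj] at h1
  obtain ⟨q, hq0, hq1⟩ := finrank_eq_one_iff'.1 h1
  refine ⟨q, fun h => hq0 (Subtype.ext h), q.2, fun f hf => ?_⟩
  obtain ⟨a, ha⟩ := hq1 ⟨f, hf⟩
  exact ⟨a, congrArg Subtype.val ha⟩

lemma exists_perp_sum_pow_eq_span {m k s : ℕ} (hs : s + 1 = m.multichoose k)
    {ℓ : Fin s → MvPolynomial (Fin m) ℂ} (hℓ : ∀ i, (ℓ i).IsHomogeneous 1)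
    (hsurj : Function.Surjective (formEval k fun i => linearFormPoint (ℓ i))) :
    ∃ q : MvPolynomial (Fin m) ℂ, q ≠ 0 ∧
      perp ((apolarPairing m).flip (∑ i, ℓ i ^ (2 * k))) (2 * k) k = Submodule.span ℂ {q} := by
  have hker : ∀ f : Form m k, formEval k (fun i => linearFormPoint (ℓ i)) f = 0 ↔
      (f : MvPolynomial (Fin m) ℂ) ∈
        perp ((apolarPairing m).flip (∑ i, ℓ i ^ (2 * k))) (2 * k) k := by
    intro f
    rw [mem_perp_sum_pow_iff hℓ hsurj f.2, funext_iff]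
    simp
  obtain ⟨q, hq0, hq, hq1⟩ := exists_ker_eq_span hsurj
    (by rw [Module.finrank_fin_fun, finrank_form, hs])
  refine ⟨q, fun h => hq0 (Subtype.ext h), le_antisymm ?_ ?_⟩
  · intro f hf
    obtain ⟨a, ha⟩ := hq1 ⟨f, hf.1⟩ ((hker _).2 hf)
    exact Submodule.mem_span_singleton.2 ⟨a, congrArg Subtype.val ha⟩
  · rw [Submodule.span_singleton_le_iff_mem]
    exact (hker q).1 hq

/-- This is the contrapositive of `exists_eq_eval_of_card_le`, and leaves only the choice of K. -/
lemma expectedLength_lt_waringRank_coneForm {m k : ℕ} (hm : 2 ≤ m) (hk : 1 ≤ k)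
    {G K q : MvPolynomial (Fin m) ℂ} (hG : G.IsHomogeneous (2 * k))
    (hK : K.IsHomogeneous (2 * k + 1)) (hq0 : q ≠ 0)
    (hq : perp ((apolarPairing m).flip G) (2 * k) k = Submodule.span ℂ {q})
    (h : ∀ (p : Fin m → ℂ) (t : ℂ), ∃ h ∈ perp ((apolarPairing m).flip G) (2 * k) (k + 1),
      apolarPairing m (h * q) K ≠ t * (eval p h * eval p q)) :
    expectedLength m k < waringRank (2 * k + 1) (coneForm G K) := by
  refine lt_waringRank ⟨coneForm G K, isHomogeneous_coneForm hG hK⟩ fun r ℓ c hℓ hF => ?_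
  by_contra! hr
  obtain ⟨ι, κ, _, _, x, w, y, b, hcard, hx, hxK⟩ := exists_points_of_coneForm_eq hℓ hF
  obtain ⟨p, t, hpt⟩ := exists_eq_eval_of_card_le (K := (apolarPairing m).flip K) hk
    (fun j hj => perp_eq_bot_of_span hm hq hj) hq hq0 hx hxK (hcard.trans_le hr)
  obtain ⟨f, hf, hne⟩ := h p t
  exact hne (hpt f hf)

/-! ### The choice of K -/

lemma pointLinearForm_add {m : ℕ} (a b : Fin m → ℂ) :
    pointLinearForm (a + b) = pointLinearForm a + pointLinearForm b := by
  simp [pointLinearForm, add_mul, Finset.sum_add_distrib]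

lemma pointLinearForm_smul {m : ℕ} (t : ℂ) (a : Fin m → ℂ) :
    pointLinearForm (t • a) = t • pointLinearForm a := by
  simp [pointLinearForm, smul_eq_C_mul, Finset.mul_sum, mul_assoc]

lemma pointLinearForm_single {m : ℕ} (i : Fin m) :
    pointLinearForm (Pi.single i 1) = X i := by
  rw [pointLinearForm, Finset.sum_eq_single i]
  · simp
  · intro j _ hj
    simp [Pi.single_eq_of_ne hj]
  · simp

lemma pointLinearForm_eq_zero {m : ℕ} {a : Fin m → ℂ} (h : pointLinearForm a = 0) : a = 0 := by
  rw [← linearFormPoint_pointLinearForm a, h]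
  ext i
  simp [linearFormPoint]

/-- Multiplication of linear forms by a fixed form `u`. -/
noncomputable def mulLinearForm {m e : ℕ} (u : Form m e) : (Fin m → ℂ) →ₗ[ℂ] Form m (e + 1) where
  toFun a := ⟨u * pointLinearForm a, IsHomogeneous.mul u.2 (isHomogeneous_pointLinearForm a)⟩
  map_add' a b := Subtype.ext (by simp [pointLinearForm_add, mul_add])
  map_smul' t a := Subtype.ext (by simp [pointLinearForm_smul])

@[simp] lemma coe_mulLinearForm {m e : ℕ} (u : Form m e) (a : Fin m → ℂ) :
    (mulLinearForm u a : MvPolynomial (Fin m) ℂ) = u * pointLinearForm a := rfl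

lemma mulLinearForm_injective {m e : ℕ} {u : Form m e} (hu : u ≠ 0) :
    Function.Injective (mulLinearForm u) := by
  rw [injective_iff_map_eq_zero]
  intro a ha
  have h1 : (u : MvPolynomial (Fin m) ℂ) * pointLinearForm a = 0 := congrArg Subtype.val ha
  exact pointLinearForm_eq_zero ((mul_eq_zero.1 h1).resolve_left fun h => hu (Subtype.ext h))

/-- A form with prescribed apolar pairings along an injective linear map. -/
lemma exists_form_apolarPairing_comp {m e : ℕ} {V : Type*} [AddCommGroup V] [Module ℂ V]
    {L : V →ₗ[ℂ] Form m e} (hL : Function.Injective L) (φ : Module.Dual ℂ V) :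
    ∃ F : Form m e, ∀ v, apolarPairing m (L v : MvPolynomial (Fin m) ℂ) F = φ v := by
  obtain ⟨ψ, hψ⟩ := LinearMap.dualMap_surjective_of_injective hL φ
  obtain ⟨F, hF⟩ := exists_form_apolarPairing ψ
  exact ⟨F, fun v => (hF (L v)).trans (LinearMap.congr_fun hψ v)⟩

lemma le_multichoose {n : ℕ} (k : ℕ) : n ≤ n.multichoose (k + 1) := by
  cases n with
  | zero => simp
  | succ n =>
    induction k with
    | zero => simp
    | succ k ih => rw [Nat.multichoose_succ_succ]; omega

section

variable {m k : ℕ} {G q : MvPolynomial (Fin m) ℂ}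

lemma mul_X_mem_perp (hk : 1 ≤ k) (hq : q ∈ perp ((apolarPairing m).flip G) (2 * k) k)
    (i : Fin m) : q * X i ∈ perp ((apolarPairing m).flip G) (2 * k) (k + 1) :=
  mul_mem_perp hq (isHomogeneous_X _ _) (by omega)

/-- If `q` vanishes at a point `a ≠ 0`, some `K` makes the rank of `X 0 * G + K` large. -/
theorem exists_expectedLength_lt_waringRank (hm : 2 ≤ m) (hk : 1 ≤ k)
    (hG : G.IsHomogeneous (2 * k)) (hq0 : q ≠ 0)
    (hq : perp ((apolarPairing m).flip G) (2 * k) k = Submodule.span ℂ {q})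
    {a : Fin m → ℂ} (ha : a ≠ 0) (hqa : eval a q = 0) :
    ∃ K : Form m (2 * k + 1), expectedLength m k <
      waringRank (2 * k + 1) (coneForm G (K : MvPolynomial (Fin m) ℂ)) := by
  have hqmem : q ∈ perp ((apolarPairing m).flip G) (2 * k) k :=
    hq ▸ Submodule.mem_span_singleton_self q
  have hqhom := hqmem.1
  let u : Form m (2 * k) := ⟨q * q, by
    rw [two_mul]; exact hqhom.mul hqhom⟩
  have hu : u ≠ 0 := fun h => mul_ne_zero hq0 hq0 (congrArg Subtype.val h)
  -- Multiplication by q² is injective on linear forms, so the values K(q² X_i) = a_i can be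
  -- prescribed.
  obtain ⟨K, hK⟩ := exists_form_apolarPairing_comp (mulLinearForm_injective hu)
    (∑ i, a i • LinearMap.proj i)
  refine ⟨K, expectedLength_lt_waringRank_coneForm hm hk hG K.2 hq0 hq fun p t => ?_⟩
  by_contra! hpt
  have h1 : ∀ i, a i = t * eval p q ^ 2 * p i := by
    intro i
    have h2 := hpt _ (mul_X_mem_perp hk hqmem i)
    have h3 := hK (Pi.single i 1)
    rw [coe_mulLinearForm, pointLinearForm_single] at h3
    rw [show q * X i * q = q * q * X i by ring, h3] at h2
    simp only [LinearMap.sum_apply, LinearMap.smul_apply, LinearMap.proj_apply, Pi.single_apply,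
      smul_eq_mul, mul_ite, mul_one, mul_zero, Finset.sum_ite_eq', Finset.mem_univ, if_true,
      map_mul, eval_X] at h2
    rw [h2]
    ring
  have h2 : a = (t * eval p q ^ 2) • p := funext h1
  -- Since q(a) = 0, homogeneity gives t q(p)² = 0 or q(p) = 0; both make a zero.
  rw [h2, eval_smul_of_isHomogeneous hqhom] at hqa
  apply ha
  rw [h2]
  rcases mul_eq_zero.1 hqa with h | h
  · rw [pow_eq_zero_iff (by omega)] at h
    rw [h, zero_smul]
  · rw [h]; simp

/-- The annihilator in degree k + 1 has dimension at least 2(m - 1) > m, while the multiples of q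
there have dimension at most m. For m = 2 the two dimensions agree, hence the restriction. -/
lemma exists_mem_perp_forall_ne (hm : 3 ≤ m) (hk : 1 ≤ k)
    (hq : perp ((apolarPairing m).flip G) (2 * k) k = Submodule.span ℂ {q}) :
    ∃ h ∈ perp ((apolarPairing m).flip G) (2 * k) (k + 1), ∀ a, h ≠ q * pointLinearForm a := by
  have hqmem : q ∈ perp ((apolarPairing m).flip G) (2 * k) k :=
    hq ▸ Submodule.mem_span_singleton_self q
  by_contra! h
  let L := (homogeneousSubmodule (Fin m) ℂ (k + 1)).subtype ∘ₗ
    mulLinearForm (⟨q, hqmem.1⟩ : Form m k)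
  have hle : perp ((apolarPairing m).flip G) (2 * k) (k + 1) ≤ LinearMap.range L := by
    intro f hf
    obtain ⟨a, ha⟩ := h f hf
    exact ⟨a, ha.symm⟩
  have h1 := (Submodule.finrank_mono hle).trans (LinearMap.finrank_range_le L)
  rw [Module.finrank_fin_fun] at h1
  have h2 := finrank_perp_add (g := (apolarPairing m).flip G) (show k + 1 ≤ 2 * k by omega)
    (perp_eq_bot_of_span (by omega) hq (by omega))
  obtain ⟨l, rfl⟩ : ∃ l, k = l + 1 := ⟨k - 1, by omega⟩
  obtain ⟨n, rfl⟩ : ∃ n, m = n + 1 := ⟨m - 1, by omega⟩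
  have h3 : 2 * (l + 1) - (l + 1 + 1) = l := by omega
  rw [h3, Nat.multichoose_succ_succ n (l + 1), Nat.multichoose_succ_succ n l] at h2
  have h4 := le_multichoose (n := n) (l + 1)
  have h5 := le_multichoose (n := n) l
  omega

/-- In at least three variables, a general `K` makes the rank of `X 0 * G + K` large. -/
theorem holdsForGeneral_expectedLength_lt_waringRank (hm : 3 ≤ m) (hk : 1 ≤ k)
    (hG : G.IsHomogeneous (2 * k)) (hq0 : q ≠ 0)
    (hq : perp ((apolarPairing m).flip G) (2 * k) k = Submodule.span ℂ {q}) :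
    HoldsForGeneral (Form m (2 * k + 1)) fun K => expectedLength m k <
      waringRank (2 * k + 1) (coneForm G (K : MvPolynomial (Fin m) ℂ)) := by
  have hqmem : q ∈ perp ((apolarPairing m).flip G) (2 * k) k :=
    hq ▸ Submodule.mem_span_singleton_self q
  have hqhom := hqmem.1
  obtain ⟨h, hh, hne⟩ := exists_mem_perp_forall_ne hm hk hq
  let P : Form m (2 * k + 1) → Fin m → ℂ := fun K i =>
    apolarPairing m (q * q * X i) (K : MvPolynomial (Fin m) ℂ)
  let T : Form m (2 * k + 1) → ℂ := fun K => apolarPairing m (h * q) (K : MvPolynomial (Fin m) ℂ)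
  have hP : ∀ i, (fun K => P K i) ∈ polynomialFunctionAlgebra (Form m (2 * k + 1)) := fun i =>
    dual_mem_polynomialFunctionAlgebra (apolarPairing m (q * q * X i) ∘ₗ Submodule.subtype _)
  have hT : T ∈ polynomialFunctionAlgebra (Form m (2 * k + 1)) :=
    dual_mem_polynomialFunctionAlgebra (apolarPairing m (h * q) ∘ₗ Submodule.subtype _)
  -- If P = t q(p)² p and T = t h(p) q(p), homogeneity gives h(P) = T q(P). This eliminates p and t
  -- and leaves a polynomial condition on K.
  refine ⟨(fun K => eval (P K) h) - T * fun K => eval (P K) q, Subalgebra.sub_mem _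
    (eval_mem_polynomialFunctionAlgebra hP h)
    (Subalgebra.mul_mem _ hT (eval_mem_polynomialFunctionAlgebra hP q)), ?_, fun K hK => ?_⟩
  · obtain ⟨a, ha⟩ : ∃ a, eval a q ≠ 0 := by
      by_contra! h0
      exact hq0 (MvPolynomial.funext fun a => by simpa using h0 a)
    let u : Form m (2 * k) := ⟨q * q, by
      rw [two_mul]; exact hqhom.mul hqhom⟩
    let v : Form m (2 * k + 1) := ⟨h * q, by
      have h1 := hh.1.mul hqhom
      rw [show k + 1 + k = 2 * k + 1 by ring] at h1
      exact h1⟩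
    let L : (Fin m → ℂ) × ℂ →ₗ[ℂ] Form m (2 * k + 1) :=
      (mulLinearForm u).coprod (LinearMap.toSpanSingleton ℂ _ v)
    have hLval : ∀ (b : Fin m → ℂ) (t : ℂ), (L (b, t) : MvPolynomial (Fin m) ℂ) =
        q * q * pointLinearForm b + t • (h * q) := fun b t => by
      simp [L, u, v]
    have hL : Function.Injective L := by
      rw [injective_iff_map_eq_zero]
      rintro ⟨b, t⟩ hbt
      have h1 := hLval b t
      rw [hbt] at h1
      have h2 : q * (q * pointLinearForm b + t • h) = 0 := by
        rw [mul_add, mul_smul_comm, mul_comm q h, ← mul_assoc, ← h1]; rfl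
      have h3 := (mul_eq_zero.1 h2).resolve_left hq0
      rcases eq_or_ne t 0 with rfl | ht
      · rw [zero_smul, add_zero] at h3
        rw [pointLinearForm_eq_zero ((mul_eq_zero.1 h3).resolve_left hq0)]
        rfl
      · refine absurd ?_ (hne (-(t⁻¹) • b))
        rw [pointLinearForm_smul, mul_smul_comm, neg_smul, eq_neg_iff_add_eq_zero,
          ← smul_right_injective _ ht |>.eq_iff, smul_add, smul_inv_smul₀ ht, smul_zero, add_comm]
        exact h3
    -- As hq is independent of the q² X_i, P and T are free. Taking P = a with q(a) ≠ 0 and this T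
    -- gives h(P) - T q(P) = 1.
    obtain ⟨K, hK⟩ := exists_form_apolarPairing_comp hL
      ((∑ i, a i • LinearMap.proj i).coprod
        (LinearMap.toSpanSingleton ℂ ℂ ((eval a h - 1) / eval a q)))
    have hPK : P K = a := by
      ext i
      have h1 := hK (Pi.single i 1, 0)
      rw [hLval, zero_smul, add_zero, pointLinearForm_single] at h1
      simp only [P]
      rw [h1]
      simp [LinearMap.sum_apply, Pi.single_apply]
    have hTK : T K = (eval a h - 1) / eval a q := by
      have h1 := hK (0, 1)
      rw [hLval, one_smul] at h1
      simp only [T]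
      have h2 : pointLinearForm (0 : Fin m → ℂ) = 0 := by simp [pointLinearForm]
      rw [h2, mul_zero, zero_add] at h1
      rw [h1]
      simp
    refine ⟨K, ?_⟩
    simp only [Pi.sub_apply, Pi.mul_apply, hPK, hTK, div_mul_cancel₀ _ ha, sub_sub_cancel]
    exact one_ne_zero
  · refine expectedLength_lt_waringRank_coneForm (by omega) hk hG K.2 hq0 hq fun p t => ?_
    by_contra! hpt
    apply hK
    have h1 : P K = (t * eval p q ^ 2) • p := by
      ext i
      have h2 := hpt _ (mul_X_mem_perp hk hqmem i)
      rw [show q * X i * q = q * q * X i by ring] at h2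
      simp only [P]
      rw [h2]
      simp only [map_mul, eval_X, Pi.smul_apply, smul_eq_mul]
      ring
    have h2 : T K = t * (eval p h * eval p q) := hpt h hh
    simp only [Pi.sub_apply, Pi.mul_apply]
    rw [h1, h2, eval_smul_of_isHomogeneous hh.1, eval_smul_of_isHomogeneous hqhom]
    ring

end

lemma formEval_surjective_point_ne_zero {m k s : ℕ} (hk : 1 ≤ k) {p : Fin s → Fin m → ℂ}
    (hp : Function.Surjective (formEval k p)) (i : Fin s) : p i ≠ 0 := by
  intro h
  obtain ⟨f, hf⟩ := hp (Pi.single i 1)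
  have h1 := congrFun hf i
  have h2 := eval_smul_of_isHomogeneous f.2 0 (p i)
  rw [zero_smul, zero_pow (by omega), zero_mul] at h2
  rw [formEval_apply, h, h2, Pi.single_eq_same] at h1
  exact zero_ne_one h1

/-- The construction of forms of large rank from a general tuple of linear forms. -/
theorem holdsForGeneral_linearForms {m k s : ℕ} (hm : 2 ≤ m) (hk : 1 ≤ k)
    (hs : s + 1 = m.multichoose k) :
    HoldsForGeneral (Fin s → Form m 1) fun ℓ =>
      (∃ K : Form m (2 * k + 1), expectedLength m k < waringRank (2 * k + 1)
        (coneForm (∑ i, (ℓ i : MvPolynomial (Fin m) ℂ) ^ (2 * k)) (K : MvPolynomial (Fin m) ℂ))) ∧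
      (3 ≤ m → HoldsForGeneral (Form m (2 * k + 1)) fun K =>
        expectedLength m k < waringRank (2 * k + 1)
          (coneForm (∑ i, (ℓ i : MvPolynomial (Fin m) ℂ) ^ (2 * k))
            (K : MvPolynomial (Fin m) ℂ))) := by
  obtain ⟨f, hf, hf0, hfP⟩ := holdsForGeneral_formEval_surjective (m := m) (e := k) (s := s)
    (by omega)
  refine ⟨f, hf, hf0, fun ℓ hℓ => ?_⟩
  have hsurj := hfP ℓ hℓ
  have hhom : ∀ i, (ℓ i : MvPolynomial (Fin m) ℂ).IsHomogeneous 1 := fun i => (ℓ i).2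
  have hG : (∑ i, (ℓ i : MvPolynomial (Fin m) ℂ) ^ (2 * k)).IsHomogeneous (2 * k) :=
    IsHomogeneous.sum _ _ _ fun i _ => by simpa using (hhom i).pow (2 * k)
  obtain ⟨q, hq0, hq⟩ := exists_perp_sum_pow_eq_span hs hhom hsurj
  refine ⟨?_, fun hm3 => holdsForGeneral_expectedLength_lt_waringRank hm3 hk hG hq0 hq⟩
  have hqmem : q ∈ perp _ (2 * k) k := hq ▸ Submodule.mem_span_singleton_self q
  -- At least one point is needed: it is the nonzero zero of q used for K.
  have hs0 : 0 < s := by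
    obtain ⟨l, rfl⟩ : ∃ l, k = l + 1 := ⟨k - 1, by omega⟩
    have := le_multichoose (n := m) l
    omega
  exact exists_expectedLength_lt_waringRank hm hk hG hq0 hq
    (formEval_surjective_point_ne_zero hk hsurj ⟨0, hs0⟩)
    ((mem_perp_sum_pow_iff hhom hsurj hqmem.1).1 hqmem ⟨0, hs0⟩)

end

theorem mainTheorem1 (n d k : ℕ) (hn : 3 ≤ n) (hd : 3 ≤ d) (hdk : d = 2 * k + 1) :
    -- the general apolar length is attained by a general form, and has the expected value
    HoldsForGeneral (Form (n - 1) (d - 1))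
      (fun H => apolarLength (H : MvPolynomial (Fin (n - 1)) ℂ) =
        generalApolarLength (n - 1) (d - 1)) ∧
    generalApolarLength (n - 1) (d - 1) =
      (n + k - 2).choose (n - 1) + (n + k - 1).choose (n - 1) ∧
    -- there is a form of larger Waring rank
    (∃ F : Form n d, generalApolarLength (n - 1) (d - 1) <
      waringRank d (F : MvPolynomial (Fin n) ℂ)) ∧
    generalApolarLength (n - 1) (d - 1) < maxWaringRank n d ∧
    -- such a form is `x₁ G + K`, with `G` a general sum of powers of linear forms
    HoldsForGeneral (Fin ((n + k - 2).choose k - 1) → Form (n - 1) 1) (fun ℓ =>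
      (∃ K : Form (n - 1) d, generalApolarLength (n - 1) (d - 1) <
        waringRank d (MvPolynomial.X (⟨0, by omega⟩ : Fin n) *
            inLastVariables n (∑ i, (ℓ i : MvPolynomial (Fin (n - 1)) ℂ) ^ (d - 1)) +
          inLastVariables n (K : MvPolynomial (Fin (n - 1)) ℂ))) ∧
      -- from four variables on, `K` can be any general form
      (4 ≤ n → HoldsForGeneral (Form (n - 1) d) (fun K =>
        generalApolarLength (n - 1) (d - 1) <
          waringRank d (MvPolynomial.X (⟨0, by omega⟩ : Fin n) *
              inLastVariables n (∑ i, (ℓ i : MvPolynomial (Fin (n - 1)) ℂ) ^ (d - 1)) +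
            inLastVariables n (K : MvPolynomial (Fin (n - 1)) ℂ))))) := by
  obtain ⟨m, rfl⟩ : ∃ m, n = m + 1 := ⟨n - 1, by omega⟩
  subst hdk
  have hk : 1 ≤ k := by omega
  have hgen : generalApolarLength (m + 1 - 1) (2 * k + 1 - 1) = expectedLength m k :=
    generalApolarLength_eq (by omega) k
  -- The binomial coefficient is the dimension of forms of degree k in m variables; it is positive,
  -- so the truncated subtraction is harmless.
  have hs : (m + 1 + k - 2).choose k - 1 + 1 = m.multichoose k := by
    rw [Nat.multichoose_eq, show m + 1 + k - 2 = m + k - 1 by omega]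
    have := Nat.choose_pos (show k ≤ m + k - 1 by omega)
    omega
  have hgeneral := holdsForGeneral_linearForms (show 2 ≤ m by omega) hk hs
  obtain ⟨F, hF⟩ : ∃ F : Form (m + 1) (2 * k + 1),
      expectedLength m k < waringRank (2 * k + 1) (F : MvPolynomial (Fin (m + 1)) ℂ) := by
    obtain ⟨f, -, ⟨ℓ, hℓ⟩, h⟩ := hgeneral
    obtain ⟨⟨K, hK⟩, -⟩ := h ℓ hℓ
    refine ⟨⟨_, isHomogeneous_coneForm (MvPolynomial.IsHomogeneous.sum _ _ _ fun i _ => ?_) K.2⟩, hK⟩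
    simpa using MvPolynomial.IsHomogeneous.pow (ℓ i).2 (2 * k)
  rw [hgen]
  refine ⟨holdsForGeneral_apolarLength (by omega) k,
    expectedLength_eq (n := m + 1) (by omega) hk, ⟨F, hF⟩,
    hF.trans_le (waringRank_le_maxWaringRank F), ?_⟩
  obtain ⟨f, hf, hf0, h⟩ := hgeneral
  -- The shift in `inLastVariables` is `Fin.succ` by definition, so `coneForm` unfolds to the form
  -- in the statement.
  exact ⟨f, hf, hf0, fun ℓ hℓ => ⟨(h ℓ hℓ).1, fun hm => (h ℓ hℓ).2 (by omega)⟩⟩
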